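/- **Theorem 3.2.** Let $O$ be a $c3$-lopsp-operation that is edge-breaking, i.e. the special vertices $v_1$ and $v_2$ are adjacent in $O$ and $v_2$ is of type $0$. Then for every integer $g\ge 1$ there is a simple 3-connected embedded graph $G$ of genus $g$ such that the (multi)graph $O(G)$ is not 3-connected. Here the following notions are used. An *embedded graph* is a finite connected multigraph with at least one edge, together with a rotation system (a cyclic order of the oriented edges at every vertex); its genus is $(2-|V|+|E|-|F|)/2$, where $F$ is the set of facial walks. It is *3-connected* if it has at least four vertices and no vertex-cut of fewer than three vertices. It is a *polyhedral embedding* if it is 3-connected, all facial walks are cycles, and any two distinct faces intersect in nothing, one vertex, or one edge. The *barycentric subdivision* $B_G$ has as its vertices the vertices (type 0), edges (type 1) and faces (type 2) of $G$, and its faces are triangles with one vertex of each type; two triangles that share an edge between a type-1 vertex $e$ and a type-2 vertex $f$ form a *double chamber*. A *lopsp-operation* is a 2-connected plane embedded multigraph $O$ with a type in $\{0,1,2\}$ for every vertex and three distinct special vertices $v_0,v_1,v_2$ such that every face is a triangle, no edge joins vertices of the same type, $v_0$ and $v_2$ are not of type 1, $v_1$ has degree 2 if it is of type 1, and all other vertices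 of type 1 have degree 4. To apply $O$ to $G$, choose a simple path $P$ in $O$ from $v_1$ to $v_2$ through $v_0$, cut $O$ open along $P$, and glue a copy of the resulting patch into every double chamber of $G$, with orientation preserved, so that the copies of $v_1$, $v_2$ and of the two copies of $v_0$ are placed at $e$, at $f$, and at the two type-0 corners, respectively. The result is the barycentric subdivision of an embedded graph, which is $O(G)$; up to isomorphism it does not depend on $P$. The operation $O$ is *$c3$* if $O(G)$ is a polyhedral embedding for every polyhedral embedding $G$. -/

import Mathlib

/-- A finite (multi)graph without isolated vertices together with a rotation system, given by its
oriented edges ("darts"): `inv` is the inverse of an oriented edge, `rot` is the permutation that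
induces the cyclic order of the oriented edges at every vertex.  Connectedness is not part of this
structure, see `EmbeddedGraph`. -/
structure RotationSystem where
  Dart : Type
  [finite : Finite Dart]
  rot : Equiv.Perm Dart
  inv : Equiv.Perm Dart
  inv_inv : ∀ d, inv (inv d) = d
  inv_ne : ∀ d, inv d ≠ d

namespace RotationSystem

attribute [instance] RotationSystem.finite

variable (R : RotationSystem)

/-- Vertices are the cycles of `rot`. -/
def Vertex : Type := Quotient (Equiv.Perm.SameCycle.setoid R.rot)

/-- Edges are the pairs `{d, inv d}`. -/
def Edge : Type := Quotient (Equiv.Perm.SameCycle.setoid R.inv)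

/-- The oriented edge `d` is followed by `rot (inv d)` on its facial walk. -/
def next : Equiv.Perm R.Dart := R.rot * R.inv

/-- Faces are the cyclic sequences of oriented edges in which consecutive ones form an angle. -/
def Face : Type := Quotient (Equiv.Perm.SameCycle.setoid R.next)

variable {R}

/-- The vertex associated with an oriented edge. -/
def src (d : R.Dart) : R.Vertex := Quotient.mk _ d

/-- The other vertex of an oriented edge. -/
def tgt (d : R.Dart) : R.Vertex := src (R.inv d)

def edgeOf (d : R.Dart) : R.Edge := Quotient.mk _ d

def faceOf (d : R.Dart) : R.Face := Quotient.mk _ d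

/-- The number of oriented edges at a vertex (a loop counts twice). -/
noncomputable def degree (v : R.Vertex) : ℕ := Nat.card {d : R.Dart // src d = v}

/-- The vertices in the boundary of a face. -/
def faceVertices (f : R.Face) : Set R.Vertex := {v | ∃ d : R.Dart, faceOf d = f ∧ src d = v}

/-- The edges in the boundary of a face. -/
def faceEdges (f : R.Face) : Set R.Edge := {e | ∃ d : R.Dart, faceOf d = f ∧ edgeOf d = e}

variable (R)

/-- No loops and no multiple edges. -/
def IsSimple : Prop :=
  (∀ d : R.Dart, src d ≠ tgt d) ∧
    ∀ d d' : R.Dart, src d = src d' → tgt d = tgt d' → d = d'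

/-- The simple graph in which two different vertices are adjacent iff some edge joins them. -/
def graph : SimpleGraph R.Vertex := SimpleGraph.fromRel fun u v => ∃ d : R.Dart, src d = u ∧ tgt d = v

/-- At least `k + 1` vertices, and no vertex-cut of fewer than `k` vertices. -/
def IsKConnected (k : ℕ) : Prop :=
  k + 1 ≤ Nat.card R.Vertex ∧ ∀ X : Set R.Vertex, X.ncard < k → (R.graph.induce Xᶜ).Connected

/-- The genus `(2 - |V| + |E| - |F|) / 2`. -/
noncomputable def genus : ℚ :=
  (2 - (Nat.card R.Vertex : ℚ) + (Nat.card R.Edge : ℚ) - (Nat.card R.Face : ℚ)) / 2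

/-- A polyhedral embedding: a 3-connected graph in which every facial walk is a cycle (no vertex
occurs twice in it) and the intersection of any two faces is empty, one vertex, or one edge. -/
def IsPolyhedral : Prop :=
  R.IsKConnected 3 ∧
  (∀ d d' : R.Dart, faceOf d = faceOf d' → src d = src d' → d = d') ∧
  ∀ f g : R.Face, f ≠ g →
    faceVertices f ∩ faceVertices g = ∅ ∨
    (∃ v, faceVertices f ∩ faceVertices g = {v} ∧ faceEdges f ∩ faceEdges g = ∅) ∨
    (∃ d : R.Dart, faceVertices f ∩ faceVertices g = {src d, tgt d} ∧
      faceEdges f ∩ faceEdges g = {edgeOf d})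

variable {R}

/-- `IsWalk u l w`: the oriented edges in `l` form, one after the other, a walk from `u` to `w`. -/
def IsWalk : R.Vertex → List R.Dart → R.Vertex → Prop
  | u, [], w => u = w
  | u, d :: l, w => src d = u ∧ IsWalk (tgt d) l w

theorem tgt_inv (d : R.Dart) : tgt (R.inv d) = src d := by
  simp [tgt, R.inv_inv]

theorem src_rot (d : R.Dart) : src (R.rot d) = src d :=
  Quotient.sound (s := Equiv.Perm.SameCycle.setoid R.rot) (by
    change R.rot.SameCycle _ _
    simp [Equiv.Perm.SameCycle.refl])

theorem IsWalk.append {l l' : List R.Dart} {u v w : R.Vertex} (h : IsWalk u l v)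
    (h' : IsWalk v l' w) : IsWalk u (l ++ l') w := by
  induction l generalizing u with
  | nil => cases h; exact h'
  | cons e l ih => exact ⟨h.1, ih h.2⟩

theorem IsWalk.succ {l : List R.Dart} {u w : R.Vertex} (h : IsWalk u l w) {d : R.Dart}
    (hd : d ∈ l) (hw : tgt d ≠ w) : ∃ y ∈ l, src y = tgt d := by
  induction l generalizing u with
  | nil => simp at hd
  | cons e l ih =>
    rcases List.mem_cons.1 hd with rfl | hd
    · cases l with
      | nil => exact absurd h.2 hw
      | cons e' l => exact ⟨e', by simp, h.2.1⟩
    · obtain ⟨y, hy, hy'⟩ := ih h.2 hd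
      exact ⟨y, by simp [hy], hy'⟩

theorem IsWalk.pred {l : List R.Dart} {u w : R.Vertex} (h : IsWalk u l w) {d : R.Dart}
    (hd : d ∈ l) (hu : src d ≠ u) : ∃ y ∈ l, tgt y = src d := by
  induction l generalizing u with
  | nil => simp at hd
  | cons e l ih =>
    rcases List.mem_cons.1 hd with rfl | hd
    · exact absurd h.1 hu
    · by_cases he : src d = tgt e
      · exact ⟨e, by simp, he.symm⟩
      · obtain ⟨y, hy, hy'⟩ := ih h.2 hd he
        exact ⟨y, by simp [hy], hy'⟩

theorem IsWalk.inv_notMem {l : List R.Dart} {u w : R.Vertex} (h : IsWalk u l w)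
    (hn : (u :: l.map tgt).Nodup) {d : R.Dart} (hd : d ∈ l) : R.inv d ∉ l := by
  induction l generalizing u with
  | nil => simp at hd
  | cons e l ih =>
    have hn' : (tgt e :: l.map tgt).Nodup := (List.nodup_cons.1 hn).2
    have hu : ∀ y ∈ e :: l, tgt y ≠ u := fun y hy hyu =>
      (List.nodup_cons.1 hn).1 (List.mem_map.2 ⟨y, hy, hyu⟩)
    intro hi
    rcases List.mem_cons.1 hd with rfl | hd
    · exact hu _ hi ((tgt_inv d).trans h.1)
    · rcases List.mem_cons.1 hi with hi | hi
      · refine hu d (by simp [hd]) ?_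
        rw [← h.1, ← hi]
        rfl
      · exact ih h.2 hn' hd hi

theorem IsWalk.src_inj {l : List R.Dart} {u w : R.Vertex} (h : IsWalk u l w)
    (hn : (u :: l.map tgt).Nodup) {d d' : R.Dart} (hd : d ∈ l) (hd' : d' ∈ l)
    (hs : src d = src d') : d = d' := by
  induction l generalizing u with
  | nil => simp at hd
  | cons e l ih =>
    have hn' : (tgt e :: l.map tgt).Nodup := (List.nodup_cons.1 hn).2
    have key : ∀ y ∈ l, src y ≠ u := by
      intro y hy hyu
      by_cases hye : src y = tgt e
      · exact (List.nodup_cons.1 hn).1 (List.mem_map.2 ⟨e, by simp, hye.symm.trans hyu⟩)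
      · obtain ⟨x, hx, hx'⟩ := h.2.pred hy hye
        exact (List.nodup_cons.1 hn).1 (List.mem_map.2 ⟨x, by simp [hx], hx'.trans hyu⟩)
    rcases List.mem_cons.1 hd with h1 | h1 <;> rcases List.mem_cons.1 hd' with h2 | h2
    · rw [h1, h2]
    · exact absurd (hs.symm.trans (h1 ▸ h.1)) (key _ h2)
    · exact absurd (hs.trans (h2 ▸ h.1)) (key _ h1)
    · exact ih h.2 hn' h1 h2

/-- The cyclic order at a vertex of degree `k` has period `k`. -/
theorem minimalPeriod_eq_degree (d : R.Dart) :
    Function.minimalPeriod R.rot d = degree (src d) := by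
  have : Fintype R.Dart := Fintype.ofFinite _
  classical
  have h := MulAction.minimalPeriod_eq_card (a := R.rot) (b := d)
  rw [← Nat.card_eq_fintype_card] at h
  refine Eq.trans h (Nat.card_congr (Equiv.subtypeEquivRight fun x => ?_))
  constructor
  · rintro ⟨⟨_, n, rfl⟩, rfl⟩
    refine Quotient.sound (s := Equiv.Perm.SameCycle.setoid R.rot) ?_
    change R.rot.SameCycle _ _
    exact Equiv.Perm.SameCycle.symm ⟨n, rfl⟩
  · intro hx
    have hx' : R.rot.SameCycle x d := Quotient.exact hx
    obtain ⟨n, hn⟩ := hx'.symm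
    exact ⟨⟨R.rot ^ n, n, rfl⟩, hn⟩

/-- Every oriented edge at the vertex of `d` is reached from `d` in less than one turn. -/
theorem exists_iterate_rot_eq {d d' : R.Dart} (h : src d' = src d) :
    ∃ n < degree (src d), R.rot^[n] d = d' := by
  have hs : R.rot.SameCycle d' d := Quotient.exact h
  obtain ⟨n, hn⟩ := hs.symm.exists_nat_pow_eq
  have hp : 0 < Function.minimalPeriod R.rot d :=
    Function.minimalPeriod_pos_of_mem_periodicPts
      (Function.Injective.mem_periodicPts R.rot.injective d)
  refine ⟨n % Function.minimalPeriod R.rot d, ?_, ?_⟩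
  · rw [← minimalPeriod_eq_degree]
    exact Nat.mod_lt _ hp
  · rw [Function.iterate_mod_minimalPeriod_eq, ← hn, Equiv.Perm.coe_pow]

theorem iterate_rot_inj (d : R.Dart) {m n : ℕ} (hm : m < degree (src d)) (hn : n < degree (src d))
    (h : R.rot^[m] d = R.rot^[n] d) : m = n := by
  rw [← minimalPeriod_eq_degree] at hm hn
  exact Function.iterate_injOn_Iio_minimalPeriod hm hn h

theorem iterate_rot_degree (d : R.Dart) : R.rot^[degree (src d)] d = d := by
  rw [← minimalPeriod_eq_degree]
  exact Function.iterate_minimalPeriod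

theorem src_iterate_rot (d : R.Dart) (n : ℕ) : src (R.rot^[n] d) = src d := by
  induction n with
  | zero => rfl
  | succ n ih => rw [Function.iterate_succ_apply', src_rot, ih]

end RotationSystem

open RotationSystem in
/-- An embedded graph: a connected graph with at least one edge, with a rotation system. -/
structure EmbeddedGraph extends RotationSystem where
  connected : toRotationSystem.graph.Connected

/-- A local orientation-preserving symmetry-preserving operation. -/
structure LopspOperation extends EmbeddedGraph where
  type : toRotationSystem.Vertex → Fin 3
  v0 : toRotationSystem.Vertex
  v1 : toRotationSystem.Vertex
  v2 : toRotationSystem.Vertex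
  v0_ne_v1 : v0 ≠ v1
  v0_ne_v2 : v0 ≠ v2
  v1_ne_v2 : v1 ≠ v2
  twoConnected : toRotationSystem.IsKConnected 2
  plane : toRotationSystem.genus = 0
  /-- Every face is a triangle: all facial walks have length three. -/
  triangle : ∀ d, toRotationSystem.next d ≠ d ∧
    toRotationSystem.next (toRotationSystem.next (toRotationSystem.next d)) = d
  type_ne : ∀ d : toRotationSystem.Dart,
    type (RotationSystem.src d) ≠ type (RotationSystem.tgt d)
  type_v0 : type v0 ≠ 1
  type_v2 : type v2 ≠ 1
  degree_v1 : type v1 = 1 → RotationSystem.degree v1 = 2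
  degree_of_type_one : ∀ v, v ≠ v0 → v ≠ v1 → v ≠ v2 → type v = 1 → RotationSystem.degree v = 4

namespace LopspOperation

open RotationSystem

variable (O : LopspOperation)

/-- `v₁` and `v₂` are adjacent and `v₂` is of type 0. -/
def IsEdgeBreaking : Prop :=
  (∃ d : O.Dart, src d = O.v1 ∧ tgt d = O.v2) ∧ O.type O.v2 = 0

/-- A simple path from `v₁` to `v₂` that contains `v₀`, split at `v₀`. -/
structure CutPath where
  /-- The part from `v₁` to `v₀`. -/
  part1 : List O.Dart
  /-- The part from `v₀` to `v₂`. -/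
  part2 : List O.Dart
  isWalk1 : IsWalk O.v1 part1 O.v0
  isWalk2 : IsWalk O.v0 part2 O.v2
  nodup : (O.v1 :: (part1 ++ part2).map tgt).Nodup

variable {O}

open Classical in
/-- The double chambers of `G` correspond to its oriented edges: the double chamber of `d` is the
union of the two chambers of the barycentric subdivision that contain the edge of `d` and the face
of `d`.  So its 1-point is the edge of `d`, its 2-point the face of `d`, and its two 0-points are
`tgt d` and `src d`.  Its boundary, with the double chamber on the same side as faces are of their
oriented edges, is `edge, tgt d, face, src d, edge`, and is the image of the boundary
`v₁, v₀, v₂, v₀, v₁` of the double chamber patch, in which the cut-path is traversed forwards and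
then backwards.  Hence beyond the copy of the forward part from `v₁` to `v₀` (and beyond that of the
backward part) lies the double chamber of `inv d`; beyond the copy of the forward part from `v₀` to
`v₂` lies the double chamber of `next d`, and beyond that of the backward part the double chamber of
`next⁻¹ d`.

`cross P G y d` is the double chamber that one enters when one leaves the copy of the face of `y`
in the double chamber `d` through (the copy of) the oriented edge `y` of `O`; for an edge that is
not in the cut-path, it is `d` itself. -/
noncomputable def cross (P : O.CutPath) (G : RotationSystem) (y : O.Dart) : Equiv.Perm G.Dart :=
  if y ∈ P.part1 ∨ O.inv y ∈ P.part1 then G.inv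
  else if y ∈ P.part2 then G.next
  else if O.inv y ∈ P.part2 then G.next⁻¹
  else 1

namespace CutPath

variable (P : O.CutPath) (G : RotationSystem)

theorem isWalk : IsWalk O.v1 (P.part1 ++ P.part2) O.v2 := P.isWalk1.append P.isWalk2

theorem cross_eq_one {y : O.Dart} (h : y ∉ P.part1 ++ P.part2)
    (h' : O.inv y ∉ P.part1 ++ P.part2) : cross P G y = 1 := by
  simp only [List.mem_append, not_or] at h h'
  simp [cross, h, h']

theorem cross_inv_apply (y : O.Dart) (d : G.Dart) :
    cross P G (O.inv y) (cross P G y d) = d := by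
  by_cases h1 : y ∈ P.part1 ∨ O.inv y ∈ P.part1
  · have h1' : O.inv y ∈ P.part1 ∨ O.inv (O.inv y) ∈ P.part1 := by
      rw [O.inv_inv]; exact h1.symm
    rw [cross, if_pos h1', cross, if_pos h1, G.inv_inv]
  · have h1' : ¬ (O.inv y ∈ P.part1 ∨ O.inv (O.inv y) ∈ P.part1) := by
      rw [O.inv_inv]; exact fun h => h1 h.symm
    by_cases h2 : y ∈ P.part2
    · have h2' : O.inv y ∉ P.part2 := fun h =>
        P.isWalk.inv_notMem P.nodup (d := y) (by simp [h2]) (by simp [h])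
      rw [cross, if_neg h1', if_neg h2', O.inv_inv, if_pos h2, cross, if_neg h1, if_pos h2]
      simp
    · by_cases h3 : O.inv y ∈ P.part2
      · rw [cross, if_neg h1', if_pos h3, cross, if_neg h1, if_neg h2, if_pos h3]
        simp
      · rw [cross, if_neg h1', if_neg h3, O.inv_inv, if_neg h2, cross, if_neg h1, if_neg h2,
          if_neg h3]
        rfl

end CutPath

/-- The graph `B_{O(G)}`: one copy of the double chamber patch `O_P` (the triangles of `O`, cut open
along the cut-path `P`) is glued into every double chamber of `G`.  The pair `(y, d)` is the copy of
the oriented edge `y` that bounds the copy of the face of `y` in the double chamber of `d`.  Beyond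
the edge `y` of that triangle lies the copy of the face of `inv y` (which is that of `rot y`) in the
double chamber `cross P G y d`. -/
noncomputable def glue (O : LopspOperation) (P : O.CutPath) (G : RotationSystem) :
    RotationSystem where
  Dart := O.Dart × G.Dart
  rot := Equiv.prodShear O.rot (cross P G)
  inv := Equiv.prodShear O.inv (cross P G)
  inv_inv := fun x => Prod.ext (O.inv_inv x.1) (P.cross_inv_apply G x.1 x.2)
  inv_ne := fun x h => O.inv_ne x.1 (congrArg Prod.fst h)

theorem type_src_rot (y : O.Dart) : O.type (src (O.rot y)) = O.type (src y) := by
  rw [src_rot]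

/-- Around a vertex the two other types alternate. -/
theorem type_tgt_rot_ne (y : O.Dart) : O.type (tgt (O.rot y)) ≠ O.type (tgt y) := by
  have h3 := (O.triangle (O.inv y)).2
  have hy : O.next (O.inv y) = O.rot y := by simp [next, O.inv_inv]
  have e1 : ∀ z : O.Dart, src (O.next z) = tgt z := fun z => by
    simp only [next, Equiv.Perm.mul_apply, src_rot]; rfl
  have h := O.type_ne (O.next (O.next (O.inv y)))
  rw [e1, ← e1 (O.next (O.next (O.inv y))), h3, hy] at h
  exact h

theorem type_tgt_rot_sq (y : O.Dart) : O.type (tgt (O.rot (O.rot y))) = O.type (tgt y) := by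
  have h1 := O.type_tgt_rot_ne y
  have h2 := O.type_tgt_rot_ne (O.rot y)
  have h3 := O.type_ne y
  have h4 := O.type_ne (O.rot y)
  have h5 := O.type_ne (O.rot (O.rot y))
  rw [type_src_rot] at h4 h5
  rw [type_src_rot] at h5
  omega

variable {G : RotationSystem} {P : O.CutPath}

theorem glue_rot (x : (O.glue P G).Dart) :
    (O.glue P G).rot x = (O.rot x.1, cross P G x.1 x.2) := rfl

theorem glue_inv (x : (O.glue P G).Dart) :
    (O.glue P G).inv x = (O.inv x.1, cross P G x.1 x.2) := rfl

namespace CutPath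

variable (P : O.CutPath) (G : RotationSystem)

theorem tgt_inj {y z : O.Dart} (hy : y ∈ P.part1 ++ P.part2) (hz : z ∈ P.part1 ++ P.part2)
    (h : tgt y = tgt z) : y = z :=
  List.inj_on_of_nodup_map (List.nodup_cons.1 P.nodup).2 hy hz h

theorem cross_part1 {y : O.Dart} (h : y ∈ P.part1) : cross P G y = G.inv := by
  simp [cross, h]

theorem cross_part2 {y : O.Dart} (h : y ∈ P.part2) : cross P G y = G.next := by
  have h1 : y ∉ P.part1 := fun h' => by
    have := List.disjoint_of_nodup_append (List.Nodup.of_map _ (List.nodup_cons.1 P.nodup).2)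
    exact this h' h
  have h2 : O.inv y ∉ P.part1 := fun h' =>
    P.isWalk.inv_notMem P.nodup (d := y) (by simp [h]) (by simp [h'])
  simp [cross, h, h1, h2]

theorem cross_inv_eq (y : O.Dart) : cross P G (O.inv y) = (cross P G y)⁻¹ := by
  rw [eq_inv_iff_mul_eq_one]
  ext d
  exact P.cross_inv_apply G y d

/-- At a vertex that is not one of the three special ones, the cut-path is absent or enters and
leaves once, within one of its parts. -/
theorem cross_around {v : O.Vertex} (h0 : v ≠ O.v0) (h1 : v ≠ O.v1) (h2 : v ≠ O.v2) :
    (∀ z : O.Dart, src z = v → cross P G z = 1) ∨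
    ∃ a b : O.Dart, a ≠ b ∧ src a = v ∧ src b = v ∧ cross P G b = (cross P G a)⁻¹ ∧
      ∀ z : O.Dart, src z = v → z ≠ a → z ≠ b → cross P G z = 1 := by
  by_cases ha : ∃ a ∈ P.part1 ++ P.part2, src a = v
  · right
    obtain ⟨a, ha, hav⟩ := ha
    have hy : ∃ y ∈ P.part1 ++ P.part2, tgt y = v ∧ cross P G y = cross P G a := by
      rcases List.mem_append.1 ha with h | h
      · obtain ⟨y, hy, hyt⟩ := P.isWalk1.pred h (by rw [hav]; exact h1)
        exact ⟨y, by simp [hy], hyt.trans hav, by rw [P.cross_part1 G h, P.cross_part1 G hy]⟩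
      · obtain ⟨y, hy, hyt⟩ := P.isWalk2.pred h (by rw [hav]; exact h0)
        exact ⟨y, by simp [hy], hyt.trans hav, by rw [P.cross_part2 G h, P.cross_part2 G hy]⟩
    obtain ⟨y, hy, hyv, hc⟩ := hy
    refine ⟨a, O.inv y, ?_, hav, hyv, by rw [cross_inv_eq, hc], ?_⟩
    · rintro rfl
      exact P.isWalk.inv_notMem P.nodup hy ha
    · intro z hz hza hzy
      refine P.cross_eq_one G (fun h => hza (P.isWalk.src_inj P.nodup h ha (hz.trans hav.symm)))
        (fun h => hzy ?_)
      rw [← P.tgt_inj h hy (by rw [tgt_inv, hz, hyv]), O.inv_inv]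
  · left
    push Not at ha
    intro z hz
    refine P.cross_eq_one G (fun h => ha z h hz) (fun h => ?_)
    obtain ⟨y, hy, hyv⟩ := P.isWalk.succ h (by rw [tgt_inv, hz]; exact h2)
    exact ha y hy (by rw [hyv, tgt_inv, hz])

/-- At `v₁`, exactly one edge belongs to the cut-path. -/
theorem cross_around_v1 : ∃ a : O.Dart, src a = O.v1 ∧ cross P G a = G.inv ∧
    ∀ z : O.Dart, src z = O.v1 → z ≠ a → cross P G z = 1 := by
  obtain ⟨a, ha, hav⟩ : ∃ a ∈ P.part1, src a = O.v1 := by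
    have h := P.isWalk1
    cases hp : P.part1 with
    | nil => rw [hp] at h; exact absurd h.symm O.v0_ne_v1
    | cons a l => rw [hp] at h; exact ⟨a, by simp, h.1⟩
  refine ⟨a, hav, P.cross_part1 G ha, fun z hz hza => P.cross_eq_one G (fun h => hza ?_)
    (fun h => ?_)⟩
  · exact P.isWalk.src_inj P.nodup h (by simp [ha]) (hz.trans hav.symm)
  · exact (List.nodup_cons.1 P.nodup).1 (List.mem_map.2 ⟨_, h, (tgt_inv z).trans hz⟩)

end CutPath

/-- A vertex of type 1 of `B_{O(G)}` has degree 4. -/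
theorem glue_rot_of_type_one {x : (O.glue P G).Dart} (hx : O.type (src x.1) = 1) :
    (O.glue P G).rot ((O.glue P G).rot ((O.glue P G).rot ((O.glue P G).rot x))) = x ∧
      (O.glue P G).rot ((O.glue P G).rot x) ≠ x := by
  obtain ⟨y, d⟩ := x
  simp only [glue_rot]
  have h0 : src y ≠ O.v0 := fun h => O.type_v0 (h ▸ hx)
  have h2 : src y ≠ O.v2 := fun h => O.type_v2 (h ▸ hx)
  by_cases h1 : src y = O.v1
  · have hdeg : degree (src y) = 2 := h1 ▸ O.degree_v1 (h1 ▸ hx)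
    have hp : O.rot (O.rot y) = y := by
      have := iterate_rot_degree y
      rwa [hdeg] at this
    have hne : O.rot y ≠ y := fun h => by
      have := iterate_rot_inj y (m := 1) (n := 0) (by omega) (by omega) h
      omega
    obtain ⟨a, hav, hca, hz⟩ := P.cross_around_v1 G
    obtain ⟨n, hn, hna⟩ := exists_iterate_rot_eq (hav.trans h1.symm)
    rw [hdeg] at hn
    have hc : ∀ e, cross P G (O.rot y) (cross P G y e) = G.inv e := by
      intro e
      interval_cases n
      · have hya : y = a := hna
        rw [hz (O.rot y) (by rw [src_rot, h1]) (hya ▸ hne), hya, hca]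
        rfl
      · have hya : O.rot y = a := hna
        rw [hz y h1 (by rw [← hya]; exact hne.symm), hya, hca]
        rfl
    refine ⟨Prod.ext ?_ ?_, fun h => G.inv_ne d ?_⟩
    · change O.rot (O.rot (O.rot (O.rot y))) = y
      rw [hp, hp]
    · change cross P G (O.rot (O.rot (O.rot y))) (cross P G (O.rot (O.rot y))
        (cross P G (O.rot y) (cross P G y d))) = d
      rw [hp, hc, hc, G.inv_inv]
    · have := congrArg Prod.snd h
      rw [← hc]
      exact this
  · have hdeg : degree (src y) = 4 := O.degree_of_type_one _ h0 h1 h2 hx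
    refine ⟨Prod.ext ?_ ?_, fun h => ?_⟩
    · have := iterate_rot_degree y
      rwa [hdeg] at this
    · change cross P G (O.rot^[3] y) (cross P G (O.rot^[2] y)
        (cross P G (O.rot^[1] y) (cross P G (O.rot^[0] y) d))) = d
      rcases P.cross_around G h0 h1 h2 with hz | ⟨a, b, hab, ha, hb, hc, hz⟩
      · rw [hz _ (src_iterate_rot y 3), hz _ (src_iterate_rot y 2), hz _ (src_iterate_rot y 1),
          hz _ (src_iterate_rot y 0)]
        rfl
      · obtain ⟨m, hm, rfl⟩ := exists_iterate_rot_eq ha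
        obtain ⟨n, hn, rfl⟩ := exists_iterate_rot_eq hb
        have hmn : m ≠ n := fun h => hab (by rw [h])
        have hk : ∀ k < 4, k ≠ m → k ≠ n → cross P G (O.rot^[k] y) = 1 := by
          intro k hk hkm hkn
          refine hz _ (src_iterate_rot y k) (fun h => hkm ?_) (fun h => hkn ?_)
          · exact iterate_rot_inj y (by omega) hm h
          · exact iterate_rot_inj y (by omega) hn h
        rw [hdeg] at hm hn
        have k0 := hk 0 (by omega)
        have k1 := hk 1 (by omega)
        have k2 := hk 2 (by omega)
        have k3 := hk 3 (by omega)
        generalize hA : cross P G (O.rot^[0] y) = A at *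
        generalize hB : cross P G (O.rot^[1] y) = B at *
        generalize hC : cross P G (O.rot^[2] y) = C at *
        generalize hD : cross P G (O.rot^[3] y) = D at *
        interval_cases m <;> interval_cases n <;> simp_all
    · have := iterate_rot_inj y (m := 2) (n := 0) (by omega) (by omega) (congrArg Prod.fst h)
      omega

/-- The oriented edges of `O(G)` are the type-2 edges of `B_{O(G)}`, directed from their vertex of
type 0 to their vertex of type 1. -/
def IsResultDart (P : O.CutPath) (G : RotationSystem) (x : (O.glue P G).Dart) : Prop :=
  O.type (src x.1) = 0 ∧ O.type (tgt x.1) = 1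

theorem isResultDart_rot (x : (O.glue P G).Dart) :
    IsResultDart P G (((O.glue P G).rot ^ 2) x) ↔ IsResultDart P G x := by
  change O.type (src (O.rot (O.rot x.1))) = 0 ∧ O.type (tgt (O.rot (O.rot x.1))) = 1 ↔ _
  rw [type_src_rot, type_src_rot, type_tgt_rot_sq]
  rfl

theorem isResultDart_inv (x : (O.glue P G).Dart) :
    IsResultDart P G (((O.glue P G).inv * (O.glue P G).rot ^ 2 * (O.glue P G).inv) x) ↔
      IsResultDart P G x := by
  change O.type (tgt (O.rot (O.rot (O.inv x.1)))) = 0 ∧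
    O.type (tgt (O.inv (O.rot (O.rot (O.inv x.1))))) = 1 ↔ _
  rw [tgt_inv, type_tgt_rot_sq, tgt_inv, type_src_rot, type_src_rot]
  rfl

/-- The result `O(G)` of applying `O` to `G` (with the cut-path `P`): the graph with a rotation
system whose barycentric subdivision is `B_{O(G)}`.  An oriented edge of `O(G)` starts at a vertex
of type 0 of `B_{O(G)}` and leads to the midpoint of an edge of `O(G)`, a vertex of type 1.  The next
one at its vertex of type 0 is the second next edge of `B_{O(G)}`, and its inverse is the opposite
edge at the vertex of type 1.  (`O(G)` is connected if `G` is; this is not recorded here.) -/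
noncomputable def apply (O : LopspOperation) (P : O.CutPath) (G : RotationSystem) :
    RotationSystem where
  Dart := {x : (O.glue P G).Dart // IsResultDart P G x}
  rot := ((O.glue P G).rot ^ 2).subtypePerm isResultDart_rot
  inv := ((O.glue P G).inv * (O.glue P G).rot ^ 2 * (O.glue P G).inv).subtypePerm isResultDart_inv
  inv_inv := fun x => Subtype.ext (by
    change (O.glue P G).inv ((O.glue P G).rot ((O.glue P G).rot ((O.glue P G).inv
      ((O.glue P G).inv ((O.glue P G).rot ((O.glue P G).rot ((O.glue P G).inv x.1))))))) = x.1
    rw [(O.glue P G).inv_inv, (glue_rot_of_type_one (x := (O.glue P G).inv x.1) x.2.2).1,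
      (O.glue P G).inv_inv])
  inv_ne := fun x h => by
    have h' : (O.glue P G).inv ((O.glue P G).rot ((O.glue P G).rot ((O.glue P G).inv x.1))) = x.1 :=
      congrArg Subtype.val h
    refine (glue_rot_of_type_one (x := (O.glue P G).inv x.1) x.2.2).2 ?_
    rw [← (O.glue P G).inv_inv ((O.glue P G).rot _), h']

/-- For each polyhedral embedding `G`, the result `O(G)` is a polyhedral embedding.  (Up to
isomorphism `O(G)` does not depend on the cut-path.) -/
def IsC3 (O : LopspOperation) : Prop :=
  ∀ G : EmbeddedGraph, G.IsPolyhedral → ∀ P : O.CutPath, (O.apply P G.toRotationSystem).IsPolyhedral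

end LopspOperation

/-!
Let `G` be a simple 3-connected embedded graph of genus `g` with exactly two faces, and let `O` be
edge-breaking. The copies of `v₂` in `B_{O(G)}` are at the faces of `G`, and they are vertices of
`O(G)`, since `v₂` has type 0; so there are at most two of them, and deleting all of them is
allowed. The copies of an edge between `v₁` and `v₂` form the dual edges of `G`, which together with
the faces of `G` cut the surface into one island around every vertex of `G`. An edge of `O(G)` that
leaves an island would pass through a copy of `v₂` or of `v₁`. If `v₁` has type 2, no edge of `O(G)`
passes through it; if it has type 1, the edge there joins copies of `v₂`. So after the deletion there
are no edges between different islands (`not_isKConnected_three_apply`). All islands contain copies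
of the same vertices of `O`, so the rest is disconnected or empty; in the latter case `O(G)` has at
most two vertices.

That an edge `v₂v₁` and the cut-path `P` separate the double chamber patch into a half for each of
the two vertices of the double chamber (`exists_side`) is an instance of the Jordan curve theorem. It
is derived from genus zero by homology: comparing dimensions with Euler's formula shows that every
closed chain of edges is the boundary of a chain of faces (`exists_boundary_eq`). The coefficients
of a chain of faces bounded by the closed walk along `P` and back along `v₂v₁` tell the sides of `P`
apart.

The graphs `G` arise from a triangle in the plane (`exists_two_faces`). A new vertex is joined to
three corners of which two lie in different faces. The facial walks restricted to the old oriented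
edges change by two transpositions, the first of which merges the two faces and the second of which
splits the result (`card_face_addVertex_eq_two`). So there are two faces again, while one vertex and
three edges are added: the genus increases by one. Simplicity is preserved, and so is the absence of
vertex-cuts with fewer than three vertices.
-/

/-! ### Cycles of permutations -/

namespace Equiv.Perm

/-- An equivalence relation that relates each point to its image relates all points of a cycle. -/
theorem SameCycle.rel_of_equivalence {α : Type*} {f : Equiv.Perm α} {r : α → α → Prop}
    (hr : Equivalence r) (h : ∀ a, r a (f a)) {a b : α} (hab : f.SameCycle a b) : r a b := by
  have key : ∀ (n : ℕ) (x : α), r x ((f ^ n) x) := by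
    intro n
    induction n with
    | zero => exact fun x => hr.refl x
    | succ n ih =>
      intro x
      rw [pow_succ', mul_apply]
      exact hr.trans (ih x) (h _)
  obtain ⟨i, rfl⟩ := hab
  obtain ⟨n, rfl | rfl⟩ := i.eq_nat_or_neg
  · simpa using key n a
  · have := key n ((f ^ (-(n : ℤ))) a)
    rw [zpow_neg, zpow_natCast, ← mul_apply, mul_inv_cancel, one_apply] at this
    rw [zpow_neg, zpow_natCast]
    exact hr.symm this

theorem SameCycle.apply_eq_of_invariant {α β : Type*} {f : Equiv.Perm α} {c : α → β}
    (h : ∀ a, c (f a) = c a) {a b : α} (hab : f.SameCycle a b) : c a = c b :=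
  hab.rel_of_equivalence (r := fun x y => c x = c y)
    ⟨fun x => Eq.refl (c x), Eq.symm, Eq.trans⟩ fun x => (h x).symm

theorem SameCycle.of_semiconj {α β : Type*} {f : Equiv.Perm α} {g : Equiv.Perm β} {j : α → β}
    (h : ∀ a, g.SameCycle (j a) (j (f a))) {a b : α} (hab : f.SameCycle a b) :
    g.SameCycle (j a) (j b) :=
  hab.rel_of_equivalence (r := fun x y => g.SameCycle (j x) (j y))
    ⟨fun _ => SameCycle.refl _ _, SameCycle.symm, SameCycle.trans⟩ h

theorem sameCycle_self_apply {α : Type*} (f : Equiv.Perm α) (a : α) : f.SameCycle a (f a) :=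
  sameCycle_apply_right.2 (SameCycle.refl f a)

theorem sameCycle_of_apply_eq {α : Type*} {f : Equiv.Perm α} {a b : α} (h : f a = b) :
    f.SameCycle a b :=
  h ▸ sameCycle_self_apply f a

theorem card_quotient_sameCycle {α T : Type*} (f : Equiv.Perm α) (c : α → T)
    (hc : Function.Surjective c) (h : ∀ a b, c a = c b ↔ f.SameCycle a b) :
    Nat.card (Quotient (SameCycle.setoid f)) = Nat.card T :=
  Nat.card_congr <| Equiv.ofBijective
    (Quotient.lift c fun a b hab => (h a b).2 hab)
    ⟨fun p q => Quotient.inductionOn₂ p q fun a b hab =>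
        Quotient.sound (s := SameCycle.setoid f) ((h a b).1 hab),
      fun t => (hc t).elim fun a ha => ⟨Quotient.mk _ a, ha⟩⟩

theorem card_quotient_sameCycle_eq_two {α : Type*} {f : Equiv.Perm α} {a b : α}
    (hab : ¬ f.SameCycle a b) (h : ∀ d, f.SameCycle d a ∨ f.SameCycle d b) :
    Nat.card (Quotient (SameCycle.setoid f)) = 2 := by
  rw [Nat.card_eq_two_iff]
  refine ⟨Quotient.mk _ a, Quotient.mk _ b, fun he => hab (Quotient.exact he), ?_⟩
  refine Set.eq_univ_of_forall fun p => Quotient.inductionOn p fun d => ?_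
  rcases h d with hd | hd
  · exact Or.inl (Quotient.sound (s := SameCycle.setoid f) hd)
  · exact Or.inr (Quotient.sound (s := SameCycle.setoid f) hd)

variable {α : Type*} [DecidableEq α] [Finite α]

/-- Until `f` leads from `d` to `a` or to `b`, the permutations `f` and `f * swap a b` agree. -/
theorem exists_sameCycle_mul_swap {f : Equiv.Perm α} {a b d : α}
    (h : f.SameCycle d a ∨ f.SameCycle d b) :
    ∃ x, (x = a ∨ x = b) ∧ f.SameCycle d x ∧ (f * swap a b).SameCycle d x := by
  classical
  have hex : ∃ n : ℕ, (f ^ n) d = a ∨ (f ^ n) d = b := by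
    rcases h with h | h
    · exact h.exists_nat_pow_eq.imp fun _ => Or.inl
    · exact h.exists_nat_pow_eq.imp fun _ => Or.inr
  have hpow : ∀ n ≤ Nat.find hex, ((f * swap a b) ^ n) d = (f ^ n) d := by
    intro n
    induction n with
    | zero => exact fun _ => rfl
    | succ n ih =>
      intro hn
      have hne := Nat.find_min hex (Nat.lt_of_succ_le hn)
      rw [not_or] at hne
      rw [pow_succ', pow_succ', mul_apply, mul_apply, ih (Nat.le_of_succ_le hn), mul_apply,
        swap_apply_of_ne_of_ne hne.1 hne.2]
  exact ⟨_, Nat.find_spec hex, ⟨Nat.find hex, by simp⟩,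
    ⟨Nat.find hex, by rw [zpow_natCast, hpow _ le_rfl]⟩⟩

/-- Multiplication by a transposition that meets both of two cycles merges them. -/
theorem sameCycle_mul_swap_of_two_cycles {f : Equiv.Perm α} {a b : α} (hab : ¬ f.SameCycle a b)
    (h : ∀ d, f.SameCycle d a ∨ f.SameCycle d b) (d e : α) : (f * swap a b).SameCycle d e := by
  have hba : (f * swap a b).SameCycle b a := by
    obtain ⟨x, hx, hfx, hgx⟩ := exists_sameCycle_mul_swap (h (f a))
    rw [sameCycle_apply_left] at hfx
    have hxa : x = a := hx.resolve_right fun hxb => hab (hxb ▸ hfx)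
    rw [hxa] at hgx
    have hb : (f * swap a b) b = f a := by simp
    rw [← sameCycle_apply_left, hb]
    exact hgx
  have key : ∀ d, (f * swap a b).SameCycle d a := by
    intro d
    obtain ⟨x, rfl | rfl, -, hgx⟩ := exists_sameCycle_mul_swap (h d)
    · exact hgx
    · exact hgx.trans hba
  exact (key d).trans (key e).symm

/-- Multiplication by a transposition splits a cyclic permutation into two cycles: there are at
most two, and a single one is impossible because the sign changes. -/
theorem two_cycles_mul_swap {f : Equiv.Perm α} {a b : α} (hab : a ≠ b)
    (h : ∀ d e, f.SameCycle d e) :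
    ¬ (f * swap a b).SameCycle a b ∧
      ∀ d, (f * swap a b).SameCycle d a ∨ (f * swap a b).SameCycle d b := by
  have hcover : ∀ d, (f * swap a b).SameCycle d a ∨ (f * swap a b).SameCycle d b := by
    intro d
    obtain ⟨x, rfl | rfl, -, hgx⟩ := exists_sameCycle_mul_swap (a := a) (b := b) (Or.inl (h d a))
    · exact Or.inl hgx
    · exact Or.inr hgx
  refine ⟨fun hg => ?_, hcover⟩
  have : Fintype α := Fintype.ofFinite α
  have hg' : ∀ d e, (f * swap a b).SameCycle d e := by
    have key : ∀ d, (f * swap a b).SameCycle d a := fun d =>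
      (hcover d).elim id fun hd => hd.trans hg.symm
    exact fun d e => (key d).trans (key e).symm
  have hsign : ∀ g : Equiv.Perm α, (∀ d e, g.SameCycle d e) →
      sign g = -(-1) ^ Fintype.card α := by
    intro g hgc
    have hmove : ∀ d, g d ≠ d := by
      intro d hd
      have : ∀ e, d = e := fun e => by
        have hfix : ∀ n : ℕ, (g ^ n) d = d := fun n => pow_apply_eq_self_of_apply_eq_self hd n
        obtain ⟨n, hn⟩ := (hgc d e).exists_nat_pow_eq
        rw [← hn, hfix]
      exact hab ((this a).symm.trans (this b))
    have hcyc : g.IsCycle := ⟨a, hmove a, fun e _ => hgc a e⟩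
    have hsupp : g.support = Finset.univ := by
      ext d
      simp [hmove d]
    rw [hcyc.sign, hsupp, Finset.card_univ]
  have h1 := hsign f h
  have h2 := hsign _ hg'
  rw [map_mul, sign_swap hab, h1] at h2
  rcases neg_one_pow_eq_or ℤˣ (Fintype.card α) with h3 | h3 <;> rw [h3] at h2 <;>
    exact absurd h2 (by decide)

end Equiv.Perm

namespace RotationSystem

open Equiv.Perm

section

variable {R : RotationSystem}

instance : Finite R.Vertex := inferInstanceAs (Finite (Quotient _))

instance : Finite R.Edge := inferInstanceAs (Finite (Quotient _))

instance : Finite R.Face := inferInstanceAs (Finite (Quotient _))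

theorem src_eq_src_iff {d d' : R.Dart} : src d = src d' ↔ R.rot.SameCycle d d' :=
  ⟨fun h => Quotient.exact h, fun h => Quotient.sound (s := SameCycle.setoid R.rot) h⟩

theorem edgeOf_eq_edgeOf_iff {d d' : R.Dart} : edgeOf d = edgeOf d' ↔ R.inv.SameCycle d d' :=
  ⟨fun h => Quotient.exact h, fun h => Quotient.sound (s := SameCycle.setoid R.inv) h⟩

theorem faceOf_eq_faceOf_iff {d d' : R.Dart} : faceOf d = faceOf d' ↔ R.next.SameCycle d d' :=
  ⟨fun h => Quotient.exact h, fun h => Quotient.sound (s := SameCycle.setoid R.next) h⟩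

theorem exists_src_eq (v : R.Vertex) : ∃ d : R.Dart, src d = v := Quotient.exists_rep v

theorem edgeOf_inv (d : R.Dart) : edgeOf (R.inv d) = edgeOf d :=
  edgeOf_eq_edgeOf_iff.2 (sameCycle_self_apply R.inv d).symm

theorem faceOf_next (d : R.Dart) : faceOf (R.next d) = faceOf d :=
  faceOf_eq_faceOf_iff.2 (sameCycle_self_apply R.next d).symm

theorem next_inv (d : R.Dart) : R.next (R.inv d) = R.rot d := by
  simp [next, R.inv_inv]

theorem faceOf_rot (d : R.Dart) : faceOf (R.rot d) = faceOf (R.inv d) := by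
  rw [← next_inv, faceOf_next]

theorem src_next (d : R.Dart) : src (R.next d) = tgt d := by
  simp only [next, mul_apply, src_rot]
  rfl

theorem src_inv (d : R.Dart) : src (R.inv d) = tgt d := rfl

theorem graph_adj {u v : R.Vertex} : R.graph.Adj u v ↔
    u ≠ v ∧ ∃ d : R.Dart, src d = u ∧ tgt d = v := by
  rw [graph, SimpleGraph.fromRel_adj]
  refine and_congr_right fun _ => ⟨?_, Or.inl⟩
  rintro (h | ⟨d, h1, h2⟩)
  · exact h
  · exact ⟨R.inv d, h2, (tgt_inv d).trans h1⟩

variable (R) in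
/-- No vertex-cut of fewer than three vertices. In contrast to `IsKConnected 3`, a triangle has this
property, which makes it a possible start for adding vertices one by one. -/
def NoSmallCut : Prop :=
  ∀ X : Set R.Vertex, X.ncard < 3 → (R.graph.induce Xᶜ).Connected

theorem NoSmallCut.connected (h : R.NoSmallCut) : R.graph.Connected := by
  have h0 := h ∅ (by simp)
  rw [Set.compl_empty] at h0
  exact (SimpleGraph.induceUnivIso R.graph).connected_iff.1 h0

end

/-! ### Adding a vertex of degree three -/


section AddVertex

variable {R : RotationSystem} {α : Fin 3 → R.Dart}

open Classical in
/-- The involution that exchanges the oriented edges `α i` with the new oriented edges that are to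
follow them in the cyclic order. -/
noncomputable def cornerSwap (α : Fin 3 → R.Dart) :
    R.Dart ⊕ (Fin 3 ⊕ Fin 3) → R.Dart ⊕ (Fin 3 ⊕ Fin 3)
  | .inl d => if h : ∃ i, α i = d then .inr (.inl h.choose) else .inl d
  | .inr (.inl i) => .inl (α i)
  | .inr (.inr i) => .inr (.inr i)

theorem cornerSwap_corner (hα : Function.Injective α) (i : Fin 3) :
    cornerSwap α (.inl (α i)) = .inr (.inl i) := by
  have h : ∃ j, α j = α i := ⟨i, rfl⟩
  rw [cornerSwap, dif_pos h, hα h.choose_spec]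

theorem cornerSwap_of_forall_ne {d : R.Dart} (hd : ∀ i, α i ≠ d) :
    cornerSwap α (.inl d) = .inl d := by
  rw [cornerSwap, dif_neg fun ⟨i, hi⟩ => hd i hi]

theorem cornerSwap_involutive (hα : Function.Injective α) :
    Function.Involutive (cornerSwap α) := by
  rintro (d | i | i)
  · by_cases hd : ∃ i, α i = d
    · obtain ⟨i, rfl⟩ := hd
      rw [cornerSwap_corner hα]
      rfl
    · push Not at hd
      rw [cornerSwap_of_forall_ne hd, cornerSwap_of_forall_ne hd]
  · exact cornerSwap_corner hα i
  · rfl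

/-- A new vertex is joined to the vertices of `α 0`, `α 1`, `α 2`. The oriented edge `inr (inl i)`
leads to the new vertex and follows `α i` in the cyclic order at its source; its inverse is
`inr (inr i)`, and these three are in the cyclic order `0, 1, 2` at the new vertex. -/
noncomputable def addVertex (α : Fin 3 → R.Dart) (hα : Function.Injective α) :
    RotationSystem where
  Dart := R.Dart ⊕ (Fin 3 ⊕ Fin 3)
  rot := Equiv.sumCongr R.rot (Equiv.sumCongr 1 (finRotate 3)) * (cornerSwap_involutive hα).toPerm
  inv := Equiv.sumCongr R.inv (Equiv.sumComm (Fin 3) (Fin 3))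
  inv_inv := by rintro (d | i | i) <;> simp [R.inv_inv]
  inv_ne := by rintro (d | i | i) <;> simp [R.inv_ne]

variable (hα : Function.Injective α)

theorem addVertex_rot_corner (i : Fin 3) :
    (addVertex α hα).rot (.inl (α i)) = .inr (.inl i) :=
  congrArg (Equiv.sumCongr R.rot (Equiv.sumCongr 1 (finRotate 3))) (cornerSwap_corner hα i)

theorem addVertex_rot_old {d : R.Dart} (hd : ∀ i, α i ≠ d) :
    (addVertex α hα).rot (.inl d) = .inl (R.rot d) :=
  congrArg (Equiv.sumCongr R.rot (Equiv.sumCongr 1 (finRotate 3))) (cornerSwap_of_forall_ne hd)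

theorem addVertex_rot_out (i : Fin 3) :
    (addVertex α hα).rot (.inr (.inl i)) = .inl (R.rot (α i)) := rfl

theorem addVertex_rot_new (i : Fin 3) :
    (addVertex α hα).rot (.inr (.inr i)) = .inr (.inr (i + 1)) :=
  congrArg (fun j => Sum.inr (Sum.inr j)) (finRotate_apply i)

theorem addVertex_next_corner (i : Fin 3) :
    (addVertex α hα).next (.inl (R.inv (α i))) = .inr (.inl i) :=
  (congrArg (fun d => (addVertex α hα).rot (.inl d)) (R.inv_inv (α i))).trans
    (addVertex_rot_corner hα i)

theorem addVertex_next_old {d : R.Dart} (hd : ∀ i, α i ≠ R.inv d) :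
    (addVertex α hα).next (.inl d) = .inl (R.next d) :=
  addVertex_rot_old hα hd

theorem addVertex_next_out (i : Fin 3) :
    (addVertex α hα).next (.inr (.inl i)) = .inr (.inr (i + 1)) :=
  addVertex_rot_new hα i

theorem addVertex_next_new (i : Fin 3) :
    (addVertex α hα).next (.inr (.inr i)) = .inl (R.rot (α i)) := rfl

/-- The vertex of an oriented edge of `addVertex α hα`, where `none` is the new vertex. -/
def addVertexSrc (α : Fin 3 → R.Dart) : R.Dart ⊕ (Fin 3 ⊕ Fin 3) → Option R.Vertex
  | .inl d => some (src d)
  | .inr (.inl i) => some (src (α i))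
  | .inr (.inr _) => none

theorem addVertexSrc_rot (x : (addVertex α hα).Dart) :
    addVertexSrc α ((addVertex α hα).rot x) = addVertexSrc α x := by
  rcases x with d | i | i
  · by_cases hd : ∃ i, α i = d
    · obtain ⟨i, rfl⟩ := hd
      exact (congrArg (addVertexSrc α) (addVertex_rot_corner hα i)).trans rfl
    · push Not at hd
      exact (congrArg (addVertexSrc α) (addVertex_rot_old hα hd)).trans
        (congrArg some (src_rot d))
  · exact congrArg some (src_rot (α i))
  · exact (congrArg (addVertexSrc α) (addVertex_rot_new hα i)).trans rfl

theorem addVertex_sameCycle_rot_old (d : R.Dart) :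
    (addVertex α hα).rot.SameCycle (.inl d) (.inl (R.rot d)) := by
  by_cases hd : ∃ i, α i = d
  · obtain ⟨i, rfl⟩ := hd
    exact (sameCycle_of_apply_eq (addVertex_rot_corner hα i)).trans
      (sameCycle_of_apply_eq (addVertex_rot_out hα i))
  · push Not at hd
    exact sameCycle_of_apply_eq (addVertex_rot_old hα hd)

theorem addVertex_src_eq_iff (x y : (addVertex α hα).Dart) :
    addVertexSrc α x = addVertexSrc α y ↔ (addVertex α hα).rot.SameCycle x y := by
  refine ⟨fun h => ?_, fun h => h.apply_eq_of_invariant (addVertexSrc_rot hα)⟩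
  have hold : ∀ d d' : R.Dart, src d = src d' →
      (addVertex α hα).rot.SameCycle (.inl d) (.inl d') := fun d d' hd =>
    (src_eq_src_iff.1 hd).of_semiconj (addVertex_sameCycle_rot_old hα)
  have hout : ∀ i, (addVertex α hα).rot.SameCycle (.inl (α i)) (.inr (.inl i)) :=
    fun i => sameCycle_of_apply_eq (addVertex_rot_corner hα i)
  have hnew1 : ∀ i, (addVertex α hα).rot.SameCycle (.inr (.inr i)) (.inr (.inr (i + 1))) :=
    fun i => sameCycle_of_apply_eq (addVertex_rot_new hα i)
  have hnew : ∀ i, (addVertex α hα).rot.SameCycle (.inr (.inr 0)) (.inr (.inr i)) := by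
    intro i
    fin_cases i
    · exact SameCycle.refl _ _
    · exact hnew1 0
    · exact (hnew1 0).trans (hnew1 1)
  rcases x with d | i | i <;> rcases y with d' | j | j
  · exact hold d d' (Option.some_injective _ h)
  · exact (hold d _ (Option.some_injective _ h)).trans (hout j)
  · exact absurd h (Option.some_ne_none _)
  · exact (hout i).symm.trans (hold _ d' (Option.some_injective _ h))
  · exact (hout i).symm.trans ((hold _ _ (Option.some_injective _ h)).trans (hout j))
  · exact absurd h (Option.some_ne_none _)
  · exact absurd h.symm (Option.some_ne_none _)
  · exact absurd h.symm (Option.some_ne_none _)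
  · exact (hnew i).symm.trans (hnew j)

theorem addVertex_src_eq_src_iff {x y : (addVertex α hα).Dart} :
    src x = src y ↔ addVertexSrc α x = addVertexSrc α y :=
  src_eq_src_iff.trans (addVertex_src_eq_iff hα x y).symm

theorem card_vertex_addVertex :
    Nat.card (addVertex α hα).Vertex = Nat.card R.Vertex + 1 := by
  refine (card_quotient_sameCycle _ (addVertexSrc α) ?_ (addVertex_src_eq_iff hα)).trans
    (Finite.card_option ..)
  rintro (_ | v)
  · exact ⟨.inr (.inr 0), rfl⟩
  · obtain ⟨d, rfl⟩ := exists_src_eq v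
    exact ⟨.inl d, rfl⟩

/-- The edge of an oriented edge of `addVertex α hα`, where `inr i` are the new edges. -/
def addVertexEdge : R.Dart ⊕ (Fin 3 ⊕ Fin 3) → R.Edge ⊕ Fin 3
  | .inl d => .inl (edgeOf d)
  | .inr (.inl i) => .inr i
  | .inr (.inr i) => .inr i

theorem card_edge_addVertex : Nat.card (addVertex α hα).Edge = Nat.card R.Edge + 3 := by
  have hcard : Nat.card (R.Edge ⊕ Fin 3) = Nat.card R.Edge + 3 := by
    rw [Nat.card_sum, Nat.card_fin]
  rw [← hcard]
  refine card_quotient_sameCycle _ addVertexEdge ?_ fun x y => ⟨fun h => ?_, fun h =>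
    h.apply_eq_of_invariant ?_⟩
  · rintro (e | i)
    · obtain ⟨d, rfl⟩ : ∃ d, edgeOf d = e := Quotient.exists_rep e
      exact ⟨.inl d, rfl⟩
    · exact ⟨.inr (.inl i), rfl⟩
  · have hnew : ∀ i, (addVertex α hα).inv.SameCycle (.inr (.inl i)) (.inr (.inr i)) :=
      fun i => sameCycle_self_apply (addVertex α hα).inv (.inr (.inl i))
    rcases x with d | i | i <;> rcases y with d' | j | j
    · exact (edgeOf_eq_edgeOf_iff.1 (Sum.inl_injective h)).of_semiconj
        fun a => sameCycle_self_apply (addVertex α hα).inv (.inl a)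
    · exact absurd h Sum.inl_ne_inr
    · exact absurd h Sum.inl_ne_inr
    · exact absurd h Sum.inr_ne_inl
    · obtain rfl : i = j := Sum.inr_injective h
      exact SameCycle.refl _ _
    · obtain rfl : i = j := Sum.inr_injective h
      exact hnew i
    · exact absurd h Sum.inr_ne_inl
    · obtain rfl : i = j := Sum.inr_injective h
      exact (hnew i).symm
    · obtain rfl : i = j := Sum.inr_injective h
      exact SameCycle.refl _ _
  · rintro (d | i | i)
    · exact congrArg Sum.inl (edgeOf_inv d)
    · rfl
    · rfl

open Classical in
/-- The facial walks of `addVertex α hα` restricted to the old oriented edges: the walk that reaches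
the corner of `α i` makes a detour through the new vertex and continues at the corner of
`α (i + 1)`. -/
noncomputable def detour (α : Fin 3 → R.Dart) : Equiv.Perm R.Dart :=
  R.next * Equiv.swap (R.inv (α 0)) (R.inv (α 1)) * Equiv.swap (R.inv (α 1)) (R.inv (α 2))

theorem detour_corner (hα : Function.Injective α) (i : Fin 3) :
    detour α (R.inv (α i)) = R.rot (α (i + 1)) := by
  classical
  have h01 : R.inv (α 0) ≠ R.inv (α 1) := fun h => by simpa using hα (R.inv.injective h)
  have h02 : R.inv (α 0) ≠ R.inv (α 2) := fun h => by simpa using hα (R.inv.injective h)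
  have h12 : R.inv (α 1) ≠ R.inv (α 2) := fun h => by simpa using hα (R.inv.injective h)
  rw [← next_inv, detour, mul_apply, mul_apply]
  fin_cases i
  · simp [Equiv.swap_apply_of_ne_of_ne h01 h02]
  · simp [Equiv.swap_apply_of_ne_of_ne h02.symm h12.symm]
  · simp

theorem detour_of_forall_ne {d : R.Dart} (hd : ∀ i, α i ≠ R.inv d) :
    detour α d = R.next d := by
  classical
  have h : ∀ i, d ≠ R.inv (α i) := fun i hi => hd i (by rw [hi, R.inv_inv])
  rw [detour, mul_apply, mul_apply, Equiv.swap_apply_of_ne_of_ne (h 1) (h 2),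
    Equiv.swap_apply_of_ne_of_ne (h 0) (h 1)]

/-- The cycle of `detour α` that is part of the facial walk of an oriented edge. -/
noncomputable def addVertexFace (α : Fin 3 → R.Dart) :
    R.Dart ⊕ (Fin 3 ⊕ Fin 3) → Quotient (SameCycle.setoid (detour α))
  | .inl d => Quotient.mk _ d
  | .inr (.inl i) => Quotient.mk _ (R.inv (α i))
  | .inr (.inr i) => Quotient.mk _ (R.rot (α i))

theorem card_face_addVertex :
    Nat.card (addVertex α hα).Face = Nat.card (Quotient (SameCycle.setoid (detour α))) := by
  have hmk : ∀ d, (Quotient.mk (SameCycle.setoid (detour α)) (detour α d)) = Quotient.mk _ d :=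
    fun d => Quotient.sound (s := SameCycle.setoid (detour α)) (sameCycle_self_apply _ d).symm
  have hold : ∀ d, (addVertex α hα).next.SameCycle (.inl d) (.inl (detour α d)) := by
    intro d
    by_cases hd : ∃ i, α i = R.inv d
    · obtain ⟨i, hi⟩ := hd
      obtain rfl : R.inv (α i) = d := by rw [hi, R.inv_inv]
      rw [detour_corner hα]
      exact (sameCycle_of_apply_eq (addVertex_next_corner hα i)).trans
        ((sameCycle_of_apply_eq (addVertex_next_out hα i)).trans
          (sameCycle_of_apply_eq (addVertex_next_new hα (i + 1))))
    · push Not at hd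
      rw [detour_of_forall_ne hd]
      exact sameCycle_of_apply_eq (addVertex_next_old hα hd)
  have hrep : ∀ x : (addVertex α hα).Dart, ∃ d, (addVertex α hα).next.SameCycle x (.inl d) ∧
      addVertexFace α x = Quotient.mk _ d := by
    rintro (d | i | i)
    · exact ⟨d, SameCycle.refl _ _, rfl⟩
    · exact ⟨_, (sameCycle_of_apply_eq (addVertex_next_corner hα i)).symm, rfl⟩
    · exact ⟨_, sameCycle_of_apply_eq (addVertex_next_new hα i), rfl⟩
  refine card_quotient_sameCycle _ (addVertexFace α) ?_ fun x y => ⟨fun h => ?_, fun h =>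
    h.apply_eq_of_invariant ?_⟩
  · exact fun q => Quotient.inductionOn q fun d => ⟨.inl d, rfl⟩
  · obtain ⟨d, hxd, hd⟩ := hrep x
    obtain ⟨e, hye, he⟩ := hrep y
    have hde : (detour α).SameCycle d e := Quotient.exact (hd.symm.trans (h.trans he))
    exact hxd.trans ((hde.of_semiconj hold).trans hye.symm)
  · rintro (d | i | i)
    · by_cases hd : ∃ i, α i = R.inv d
      · obtain ⟨i, hi⟩ := hd
        obtain rfl : R.inv (α i) = d := by rw [hi, R.inv_inv]
        exact (congrArg (addVertexFace α) (addVertex_next_corner hα i)).trans rfl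
      · push Not at hd
        refine (congrArg (addVertexFace α) (addVertex_next_old hα hd)).trans ?_
        rw [← detour_of_forall_ne hd]
        exact hmk d
    · refine (congrArg (addVertexFace α) (addVertex_next_out hα i)).trans ?_
      change Quotient.mk _ (R.rot (α (i + 1))) = Quotient.mk _ (R.inv (α i))
      rw [← detour_corner hα]
      exact hmk _
    · rfl

/-- If two faces are present and two of the corners lie in different ones, then adding the vertex
does not change the number of faces: the first transposition in `detour` merges the two faces, the
second splits the result. -/
theorem card_face_addVertex_eq_two (h2 : ∀ f : R.Face,
      f = faceOf (R.inv (α 0)) ∨ f = faceOf (R.inv (α 1)))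
    (h01 : faceOf (R.inv (α 0)) ≠ faceOf (R.inv (α 1))) :
    Nat.card (addVertex α hα).Face = 2 := by
  classical
  have h12 : R.inv (α 1) ≠ R.inv (α 2) := fun h => by simpa using hα (R.inv.injective h)
  rw [card_face_addVertex]
  have hone := sameCycle_mul_swap_of_two_cycles (f := R.next)
    (fun h => h01 (faceOf_eq_faceOf_iff.2 h))
    fun d => (h2 (faceOf d)).imp faceOf_eq_faceOf_iff.1 faceOf_eq_faceOf_iff.1
  obtain ⟨hne, hcover⟩ := two_cycles_mul_swap h12 hone
  have hdet : detour α = R.next * Equiv.swap (R.inv (α 0)) (R.inv (α 1)) *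
      Equiv.swap (R.inv (α 1)) (R.inv (α 2)) := by
    unfold detour
    congr!
  rw [← hdet] at hne hcover
  exact card_quotient_sameCycle_eq_two hne hcover

theorem IsSimple.addVertex (hR : R.IsSimple) (hs : Function.Injective fun i => src (α i)) :
    (addVertex α hα).IsSimple := by
  constructor
  · intro x
    rw [tgt, Ne, addVertex_src_eq_src_iff]
    rcases x with d | i | i
    · exact fun h => hR.1 d (Option.some_injective _ h)
    · exact Option.some_ne_none _
    · exact (Option.some_ne_none _).symm
  · intro x y h1 h2
    rw [addVertex_src_eq_src_iff] at h1
    rw [tgt, tgt, addVertex_src_eq_src_iff] at h2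
    rcases x with d | i | i <;> rcases y with d' | j | j
    · rw [hR.2 d d' (Option.some_injective _ h1) (Option.some_injective _ h2)]
    · exact absurd h2 (Option.some_ne_none _)
    · exact absurd h1 (Option.some_ne_none _)
    · exact absurd h2.symm (Option.some_ne_none _)
    · rw [hs (Option.some_injective _ h1)]
    · exact absurd h1 (Option.some_ne_none _)
    · exact absurd h1.symm (Option.some_ne_none _)
    · exact absurd h1.symm (Option.some_ne_none _)
    · rw [hs (Option.some_injective _ h2)]

/-- An old vertex as a vertex of `addVertex α hα`. -/
noncomputable def oldVertex (v : R.Vertex) : (addVertex α hα).Vertex :=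
  Quotient.lift (fun d : R.Dart => (src (.inl d : (addVertex α hα).Dart)))
    (fun _ _ h => (addVertex_src_eq_src_iff hα).2 (congrArg some (src_eq_src_iff.2 h))) v

theorem oldVertex_injective : Function.Injective (oldVertex hα) := by
  intro u v h
  obtain ⟨d, rfl⟩ := exists_src_eq u
  obtain ⟨e, rfl⟩ := exists_src_eq v
  exact Option.some_injective _ ((addVertex_src_eq_src_iff hα).1 h)

theorem eq_oldVertex_or_new (w : (addVertex α hα).Vertex) :
    (∃ v, w = oldVertex hα v) ∨ w = src (.inr (.inr 0) : (addVertex α hα).Dart) := by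
  obtain ⟨x, rfl⟩ := exists_src_eq w
  rcases x with d | i | i
  · exact Or.inl ⟨src d, rfl⟩
  · exact Or.inl ⟨src (α i), (addVertex_src_eq_src_iff hα).2 rfl⟩
  · exact Or.inr ((addVertex_src_eq_src_iff hα).2 rfl)

theorem oldVertex_adj {u v : R.Vertex} (h : R.graph.Adj u v) :
    (addVertex α hα).graph.Adj (oldVertex hα u) (oldVertex hα v) := by
  obtain ⟨hne, d, rfl, rfl⟩ := graph_adj.1 h
  exact graph_adj.2 ⟨fun h => hne (oldVertex_injective hα h), .inl d, rfl, rfl⟩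

theorem oldVertex_adj_new (i : Fin 3) : (addVertex α hα).graph.Adj (oldVertex hα (src (α i)))
    (src (.inr (.inr 0) : (addVertex α hα).Dart)) := by
  refine graph_adj.2 ⟨fun h => ?_, .inr (.inl i), (addVertex_src_eq_src_iff hα).2 rfl,
    (addVertex_src_eq_src_iff hα).2 rfl⟩
  exact absurd ((addVertex_src_eq_src_iff hα).1 h) (Option.some_ne_none _)

/-- A set of at most two vertices does not contain all neighbours of the new vertex, and the graph
of the old vertices that it leaves is connected. -/
theorem NoSmallCut.addVertex (hR : R.NoSmallCut) (hs : Function.Injective fun i => src (α i)) :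
    (addVertex α hα).NoSmallCut := by
  intro X hX
  have hY : (oldVertex hα ⁻¹' X).ncard < 3 := by
    refine lt_of_le_of_lt ?_ hX
    rw [← Set.ncard_image_of_injective _ (oldVertex_injective hα)]
    exact Set.ncard_le_ncard (Set.image_preimage_subset _ _)
  have hconn := hR _ hY
  let φ : R.graph.induce (oldVertex hα ⁻¹' X)ᶜ →g (RotationSystem.addVertex α hα).graph.induce Xᶜ :=
    { toFun := fun v => ⟨oldVertex hα v.1, v.2⟩
      map_rel' := fun {_ _} h => oldVertex_adj hα h }
  have hφ : ∀ (v w) (hv : oldVertex hα v ∈ Xᶜ) (hw : oldVertex hα w ∈ Xᶜ),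
      ((RotationSystem.addVertex α hα).graph.induce Xᶜ).Reachable ⟨_, hv⟩ ⟨_, hw⟩ :=
    fun v w hv hw => (hconn.preconnected ⟨v, hv⟩ ⟨w, hw⟩).map φ
  obtain ⟨i, hi⟩ : ∃ i, oldVertex hα (src (α i)) ∉ X := by
    by_contra! hall
    have hsub : Set.range (fun i => oldVertex hα (src (α i))) ⊆ X := by
      rintro _ ⟨i, rfl⟩
      exact hall i
    have hcard := Set.ncard_le_ncard hsub
    have hinj : Function.Injective fun i => oldVertex hα (src (α i)) :=
      (oldVertex_injective hα).comp hs
    rw [← Set.image_univ, Set.ncard_image_of_injective _ hinj, Set.ncard_univ, Nat.card_fin]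
      at hcard
    omega
  have : Nonempty (Xᶜ : Set _) := ⟨⟨_, hi⟩⟩
  refine (SimpleGraph.connected_iff_exists_forall_reachable _).2 ⟨⟨_, hi⟩, ?_⟩
  rintro ⟨w, hw⟩
  rcases eq_oldVertex_or_new hα w with ⟨v, rfl⟩ | rfl
  · exact hφ _ _ hi hw
  · exact SimpleGraph.Adj.reachable (oldVertex_adj_new hα i)

end AddVertex

/-! ### Graphs with two faces of every genus -/

/-- The triangle in the plane. The vertices are `Fin 3`, and at `i` the oriented edges `(i, true)`
and `(i, false)` lead to `i + 1` and `i - 1`. -/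
abbrev triangle : RotationSystem where
  Dart := Fin 3 × Bool
  rot := ⟨fun x => (x.1, !x.2), fun x => (x.1, !x.2), by decide, by decide⟩
  inv := ⟨fun x => (if x.2 then x.1 + 1 else x.1 - 1, !x.2),
    fun x => (if x.2 then x.1 + 1 else x.1 - 1, !x.2), by decide, by decide⟩
  inv_inv := by decide
  inv_ne := by decide

theorem triangle_src_eq_iff (x y : triangle.Dart) :
    x.1 = y.1 ↔ triangle.rot.SameCycle x y := by
  refine ⟨fun h => ?_, fun h => h.apply_eq_of_invariant fun _ => rfl⟩
  obtain ⟨i, b⟩ := x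
  obtain ⟨j, c⟩ := y
  obtain rfl : i = j := h
  by_cases hbc : b = c
  · subst hbc
    exact SameCycle.refl _ _
  · refine sameCycle_of_apply_eq (Prod.ext rfl ?_)
    change (!b) = c
    cases b <;> cases c <;> simp_all

theorem triangle_src_eq_src_iff {x y : triangle.Dart} : src x = src y ↔ x.1 = y.1 :=
  src_eq_src_iff.trans (triangle_src_eq_iff x y).symm

theorem triangle_card_vertex : Nat.card triangle.Vertex = 3 := by
  refine (card_quotient_sameCycle _ Prod.fst ?_ triangle_src_eq_iff).trans (Nat.card_fin 3)
  exact fun i => ⟨(i, true), rfl⟩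

theorem triangle_card_edge : Nat.card triangle.Edge = 3 := by
  refine (card_quotient_sameCycle triangle.inv
    (fun x => if x.2 then x.1 else x.1 - 1) ?_ fun x y => ?_).trans (Nat.card_fin 3)
  · exact fun i => ⟨(i, true), rfl⟩
  · refine ⟨fun h => ?_, fun h => h.apply_eq_of_invariant
      (c := fun x => if x.2 then x.1 else x.1 - 1) (by decide)⟩
    have h1 : ∀ x y : Fin 3 × Bool,
      (if x.2 then x.1 else x.1 - 1) = (if y.2 then y.1 else y.1 - 1) →
      x = y ∨ triangle.inv x = y := by decide
    rcases h1 x y h with rfl | rfl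
    · exact SameCycle.refl _ _
    · exact sameCycle_self_apply _ _

theorem triangle_card_face : Nat.card triangle.Face = 2 := by
  refine (card_quotient_sameCycle triangle.next Prod.snd ?_ fun x y => ?_).trans
    (Nat.card_eq_fintype_card.trans Fintype.card_bool)
  · exact fun b => ⟨(0, b), rfl⟩
  · refine ⟨fun h => ?_, fun h => h.apply_eq_of_invariant (by decide)⟩
    have h1 : ∀ x y : Fin 3 × Bool, x.2 = y.2 →
      x = y ∨ triangle.next x = y ∨ triangle.next (triangle.next x) = y := by decide
    rcases h1 x y h with rfl | rfl | rfl
    · exact SameCycle.refl _ _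
    · exact sameCycle_self_apply _ _
    · exact (sameCycle_self_apply _ _).trans (sameCycle_self_apply _ _)

theorem triangle_isSimple : triangle.IsSimple := by
  constructor
  · intro x
    rw [tgt, Ne, triangle_src_eq_src_iff]
    revert x
    decide
  · intro x y h1 h2
    rw [triangle_src_eq_src_iff] at h1
    rw [tgt, tgt, triangle_src_eq_src_iff] at h2
    revert x y
    decide

theorem triangle_noSmallCut : triangle.NoSmallCut := by
  intro X hX
  obtain ⟨v, hv⟩ : (Xᶜ).Nonempty := by
    rw [Set.nonempty_compl]
    rintro rfl
    rw [Set.ncard_univ, triangle_card_vertex] at hX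
    omega
  refine (SimpleGraph.connected_iff_exists_forall_reachable _).2 ⟨⟨v, hv⟩, ?_⟩
  rintro ⟨w, hw⟩
  by_cases hvw : v = w
  · subst hvw
    exact SimpleGraph.Reachable.refl _
  · refine SimpleGraph.Adj.reachable (graph_adj.2 ⟨hvw, ?_⟩)
    obtain ⟨x, rfl⟩ := exists_src_eq v
    obtain ⟨y, rfl⟩ := exists_src_eq w
    rw [triangle_src_eq_src_iff] at hvw
    obtain ⟨z, hz1, hz2⟩ : ∃ z : triangle.Dart, z.1 = x.1 ∧ (triangle.inv z).1 = y.1 := by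
      clear hv hw
      revert x y
      decide
    exact ⟨z, triangle_src_eq_src_iff.2 hz1, triangle_src_eq_src_iff.2 hz2⟩

/-- Each addition of a vertex of degree three that keeps the number of faces raises the genus by
one. -/
theorem exists_two_faces (g : ℕ) : ∃ R : RotationSystem, R.IsSimple ∧ R.NoSmallCut ∧
    Nat.card R.Vertex = g + 3 ∧ Nat.card R.Edge = 3 * g + 3 ∧ Nat.card R.Face = 2 := by
  induction g with
  | zero => exact ⟨triangle, triangle_isSimple, triangle_noSmallCut, triangle_card_vertex,
      triangle_card_edge, triangle_card_face⟩
  | succ g ih =>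
    obtain ⟨R, hsimple, hcut, hV, hE, hF⟩ := ih
    obtain ⟨f₀, f₁, hf, huniv⟩ := Nat.card_eq_two_iff.1 hF
    obtain ⟨d, rfl⟩ : ∃ d, faceOf d = f₀ := Quotient.exists_rep f₀
    -- The second face has two vertices, one of which differs from the chosen vertex of the first.
    obtain ⟨e, rfl, hde⟩ : ∃ e, faceOf e = f₁ ∧ tgt e ≠ tgt d := by
      obtain ⟨e, rfl⟩ : ∃ e, faceOf e = f₁ := Quotient.exists_rep f₁
      by_cases he : tgt e = tgt d
      · refine ⟨R.next e, faceOf_next e, fun h => hsimple.1 (R.next e) ?_⟩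
        rw [src_next, he, h]
      · exact ⟨e, rfl, he⟩
    obtain ⟨v, hv⟩ : ∃ v, v ∉ ({tgt d, tgt e} : Set R.Vertex) := by
      by_contra! hall
      have h1 := Set.ncard_le_ncard (s := Set.univ) (fun v _ => hall v)
      rw [Set.ncard_univ, hV] at h1
      have h2 := Set.ncard_insert_le (tgt d) {tgt e}
      rw [Set.ncard_singleton] at h2
      omega
    obtain ⟨c, rfl⟩ := exists_src_eq v
    simp only [Set.mem_insert_iff, Set.mem_singleton_iff, not_or] at hv
    let α : Fin 3 → R.Dart := ![R.inv d, R.inv e, c]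
    have hs : Function.Injective fun i => src (α i) := by
      intro i j hij
      fin_cases i <;> fin_cases j
      · rfl
      · exact absurd hij.symm hde
      · exact absurd hij.symm hv.1
      · exact absurd hij hde
      · rfl
      · exact absurd hij.symm hv.2
      · exact absurd hij hv.1
      · exact absurd hij hv.2
      · rfl
    have hα : Function.Injective α := fun i j hij => hs (congrArg src hij)
    have hi0 : faceOf (R.inv (α 0)) = faceOf d := congrArg faceOf (R.inv_inv d)
    have hi1 : faceOf (R.inv (α 1)) = faceOf e := congrArg faceOf (R.inv_inv e)
    refine ⟨addVertex α hα, hsimple.addVertex hα hs, hcut.addVertex hα hs, ?_, ?_, ?_⟩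
    · rw [card_vertex_addVertex, hV]
    · rw [card_edge_addVertex, hE]
      ring
    · refine card_face_addVertex_eq_two hα (fun f => ?_) (by rwa [hi0, hi1])
      rw [hi0, hi1]
      have : f ∈ ({faceOf d, faceOf e} : Set R.Face) := huniv ▸ Set.mem_univ f
      simpa using this

end RotationSystem

open RotationSystem in
theorem EmbeddedGraph.exists_two_faces (g : ℕ) (hg : 0 < g) : ∃ G : EmbeddedGraph,
    G.IsSimple ∧ G.IsKConnected 3 ∧ G.genus = g ∧ Nat.card G.Face = 2 := by
  obtain ⟨R, hsimple, hcut, hV, hE, hF⟩ := RotationSystem.exists_two_faces g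
  refine ⟨⟨R, hcut.connected⟩, hsimple, ⟨?_, hcut⟩, ?_, hF⟩
  · change 3 + 1 ≤ Nat.card R.Vertex
    omega
  · change R.genus = g
    rw [genus, hV, hE, hF]
    push_cast
    ring

namespace RotationSystem

open Equiv.Perm

/-! ### Closed chains in the plane bound -/

section Homology

variable {R : RotationSystem}

theorem eq_of_forall_src_eq_tgt {β : Type*} (hR : R.graph.Connected) {q : R.Vertex → β}
    (h : ∀ d : R.Dart, q (src d) = q (tgt d)) (u v : R.Vertex) : q u = q v := by
  obtain ⟨w⟩ := hR.preconnected u v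
  induction w with
  | nil => rfl
  | cons hadj _ ih =>
    obtain ⟨-, d, rfl, rfl⟩ := graph_adj.1 hadj
    exact (h d).trans ih

/-- The dual graph of a connected embedded graph is connected. -/
theorem eq_of_forall_faceOf_eq_faceOf_inv {β : Type*} (hR : R.graph.Connected) {h : R.Face → β}
    (hh : ∀ d : R.Dart, h (faceOf d) = h (faceOf (R.inv d))) (f g : R.Face) : h f = h g := by
  let q : R.Vertex → β := Quotient.lift (fun d : R.Dart => h (faceOf d)) fun _ _ hd =>
    SameCycle.apply_eq_of_invariant (c := fun d : R.Dart => h (faceOf d))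
      (fun d => by rw [faceOf_rot, ← hh]) hd
  obtain ⟨d, rfl⟩ : ∃ d, faceOf d = f := Quotient.exists_rep f
  obtain ⟨e, rfl⟩ : ∃ e, faceOf e = g := Quotient.exists_rep g
  exact eq_of_forall_src_eq_tgt hR (q := q) hh (src d) (src e)

theorem finrank_le_one_of_forall_eq {ι : Type*} [Finite ι] (K : Submodule ℚ (ι → ℚ))
    (hK : ∀ p ∈ K, ∀ i j, p i = p j) : Module.finrank ℚ K ≤ 1 := by
  have hle : K ≤ Submodule.span ℚ {(1 : ι → ℚ)} := by
    intro p hp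
    rcases isEmpty_or_nonempty ι with hι | ⟨⟨i⟩⟩
    · rw [Subsingleton.elim p 0]
      exact zero_mem _
    · refine Submodule.mem_span_singleton.2 ⟨p i, funext fun j => ?_⟩
      simp [hK p hp i j]
  refine (Submodule.finrank_mono hle).trans ?_
  simpa using finrank_span_le_card (R := ℚ) ({(1 : ι → ℚ)} : Set (ι → ℚ))

variable (R) in
/-- The chains of edges with rational coefficients, as functions on the oriented edges. -/
def chains : Submodule ℚ (R.Dart → ℚ) where
  carrier := {c | ∀ d, c (R.inv d) = -c d}
  add_mem' ha hb d := by simp [ha d, hb d]; ring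
  zero_mem' d := by simp
  smul_mem' r a ha d := by simp [ha d]

variable (R) in
theorem finrank_chains_le : Module.finrank ℚ R.chains ≤ Nat.card R.Edge := by
  have : Fintype R.Edge := Fintype.ofFinite _
  let φ : R.chains →ₗ[ℚ] (R.Edge → ℚ) := (LinearMap.funLeft ℚ ℚ Quotient.out).comp R.chains.subtype
  have hφ : Function.Injective φ := by
    rw [← LinearMap.ker_eq_bot, LinearMap.ker_eq_bot']
    rintro ⟨c, hc⟩ h0
    ext d
    have hd : c (Quotient.out (edgeOf d)) = 0 := congrFun h0 (edgeOf d)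
    have hsame : R.inv.SameCycle (Quotient.out (edgeOf d)) d :=
      edgeOf_eq_edgeOf_iff.1 (Quotient.out_eq _)
    refine (hsame.apply_eq_of_invariant (c := fun d => c d = 0) fun a => ?_).mp hd
    simp [hc a]
  have h := LinearMap.finrank_le_finrank_of_injective hφ
  rwa [Module.finrank_fintype_fun_eq_card, ← Nat.card_eq_fintype_card] at h

variable (R) in
/-- The boundary of a chain of faces. -/
def boundary : (R.Face → ℚ) →ₗ[ℚ] (R.Dart → ℚ) where
  toFun h d := h (faceOf d) - h (faceOf (R.inv d))
  map_add' a b := by ext d; simp; ring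
  map_smul' r a := by ext d; simp; ring

variable (R) in
/-- The potential differences of a function on the vertices. -/
def gradient : (R.Vertex → ℚ) →ₗ[ℚ] (R.Dart → ℚ) where
  toFun p d := p (src d) - p (tgt d)
  map_add' a b := by ext d; simp; ring
  map_smul' r a := by ext d; simp; ring

theorem range_gradient_le : LinearMap.range R.gradient ≤ R.chains := by
  rintro _ ⟨p, rfl⟩ d
  simp [gradient, tgt_inv, src_inv]

variable [Fintype R.Dart]

variable (R) in
/-- The chains without boundary: as much flows into every vertex as flows out of it. -/
def cycles : Submodule ℚ (R.Dart → ℚ) where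
  carrier := {c | (∀ d, c (R.inv d) = -c d) ∧ ∀ p : R.Vertex → ℚ, ∑ d, c d * p (src d) = 0}
  add_mem' ha hb := ⟨R.chains.add_mem ha.1 hb.1, fun p => by
    simp [add_mul, Finset.sum_add_distrib, ha.2 p, hb.2 p]⟩
  zero_mem' := ⟨R.chains.zero_mem, fun p => by simp⟩
  smul_mem' r a ha := ⟨R.chains.smul_mem r ha.1, fun p => by
    simp [mul_assoc, ← Finset.mul_sum, ha.2 p]⟩

theorem range_boundary_le : LinearMap.range R.boundary ≤ R.cycles := by
  rintro _ ⟨h, rfl⟩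
  refine ⟨fun d => ?_, fun p => ?_⟩
  · simp [boundary, R.inv_inv]
  · have hsum := Equiv.sum_comp R.rot fun d => h (faceOf d) * p (src d)
    simp only [faceOf_rot, src_rot] at hsum
    simp [boundary, sub_mul, Finset.sum_sub_distrib, hsum]

/-- A chain without boundary is orthogonal to all gradients. -/
theorem disjoint_cycles_range_gradient : Disjoint R.cycles (LinearMap.range R.gradient) := by
  rw [Submodule.disjoint_def]
  rintro _ ⟨hanti, hc⟩ ⟨p, rfl⟩
  set c := R.gradient p with hcp
  have h1 : ∑ d, c d * p (tgt d) = 0 := by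
    have h := Equiv.sum_comp R.inv fun d => c d * p (src d)
    simp only [hanti, src_inv, neg_mul, Finset.sum_neg_distrib] at h
    rw [hc p] at h
    linarith
  have h2 : ∑ d, c d * c d = 0 := by
    have : ∀ d, c d * c d = c d * p (src d) - c d * p (tgt d) := fun d => by
      rw [← mul_sub]
      rfl
    simp only [this, Finset.sum_sub_distrib, hc p, h1, sub_zero]
  rw [Finset.sum_eq_zero_iff_of_nonneg fun d _ => mul_self_nonneg _] at h2
  ext d
  simpa using h2 d (Finset.mem_univ d)

/-- In the plane every chain without boundary is the boundary of a chain of faces. Both spaces of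
chains have dimension `|F| - 1`: the cycles because they are orthogonal to the gradients, whose
space has dimension `|V| - 1`, within the space of chains, of dimension `|E|`. -/
theorem exists_boundary_eq (hR : R.graph.Connected) (hg : R.genus = 0) {c : R.Dart → ℚ}
    (hc : c ∈ R.cycles) : ∃ h : R.Face → ℚ, ∀ d, h (faceOf d) - h (faceOf (R.inv d)) = c d := by
  have : Fintype R.Vertex := Fintype.ofFinite _
  have : Fintype R.Face := Fintype.ofFinite _
  have hδ := LinearMap.finrank_range_add_finrank_ker R.boundary
  have hδ1 : Module.finrank ℚ (LinearMap.ker R.boundary) ≤ 1 :=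
    finrank_le_one_of_forall_eq _ fun h hh =>
      eq_of_forall_faceOf_eq_faceOf_inv hR fun d => sub_eq_zero.1 (congrFun hh d)
  have hgrad := LinearMap.finrank_range_add_finrank_ker R.gradient
  have hgrad1 : Module.finrank ℚ (LinearMap.ker R.gradient) ≤ 1 :=
    finrank_le_one_of_forall_eq _ fun p hp =>
      eq_of_forall_src_eq_tgt hR fun d => sub_eq_zero.1 (congrFun hp d)
  rw [Module.finrank_fintype_fun_eq_card, ← Nat.card_eq_fintype_card] at hδ hgrad
  have hsup := Submodule.finrank_sup_add_finrank_inf_eq R.cycles (LinearMap.range R.gradient)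
  rw [disjoint_cycles_range_gradient.eq_bot, finrank_bot, add_zero] at hsup
  have hle : R.cycles ⊔ LinearMap.range R.gradient ≤ R.chains :=
    sup_le (fun _ h => h.1) range_gradient_le
  have hE := (Submodule.finrank_mono hle).trans (finrank_chains_le R)
  have heuler : Nat.card R.Edge + 2 = Nat.card R.Vertex + Nat.card R.Face := by
    rw [genus] at hg
    have : (Nat.card R.Edge : ℚ) + 2 = Nat.card R.Vertex + Nat.card R.Face := by linarith
    exact_mod_cast this
  have heq : LinearMap.range R.boundary = R.cycles :=
    Submodule.eq_of_le_of_finrank_le range_boundary_le (by omega)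
  rw [← heq] at hc
  obtain ⟨h, rfl⟩ := hc
  exact ⟨h, fun _ => rfl⟩

end Homology

/-! ### The chain of a walk -/

section WalkChain

variable {R : RotationSystem}

open Classical in
/-- How often a list of oriented edges passes through an edge in the given direction, minus the
number of times in the opposite direction. -/
noncomputable def walkChain (l : List R.Dart) (d : R.Dart) : ℚ :=
  l.count d - l.count (R.inv d)

theorem walkChain_mem_cycles [Fintype R.Dart] {u : R.Vertex} {l : List R.Dart}
    (hl : IsWalk u l u) : walkChain l ∈ R.cycles := by
  classical
  refine ⟨fun d => by simp [walkChain, R.inv_inv], fun p => ?_⟩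
  have key : ∀ (l : List R.Dart) (u w : R.Vertex), IsWalk u l w →
      ∑ d, walkChain l d * p (src d) = p u - p w := by
    intro l
    induction l with
    | nil =>
      rintro u w rfl
      simp [walkChain]
    | cons e l ih =>
      rintro u w ⟨rfl, hw⟩
      have hcons : ∀ d, walkChain (e :: l) d * p (src d) = walkChain l d * p (src d) +
          ((if e = d then p (src d) else 0) - if R.inv e = d then p (src d) else 0) := by
        intro d
        have hinv : e = R.inv d ↔ R.inv e = d :=
          ⟨fun h => by rw [h, R.inv_inv], fun h => by rw [← h, R.inv_inv]⟩
        simp only [walkChain, List.count_cons, beq_iff_eq, hinv]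
        split_ifs <;> push_cast <;> ring
      simp only [hcons, Finset.sum_add_distrib, Finset.sum_sub_distrib, ih _ _ hw,
        Finset.sum_ite_eq, Finset.mem_univ, if_true, src_inv]
      ring
  rw [key l u u hl, sub_self]

theorem walkChain_eq_zero {l : List R.Dart} {d : R.Dart} (h : d ∉ l) (h' : R.inv d ∉ l) :
    walkChain l d = 0 := by
  classical
  simp [walkChain, List.count_eq_zero_of_not_mem h, List.count_eq_zero_of_not_mem h']

theorem walkChain_eq_one {l : List R.Dart} (hn : l.Nodup) {d : R.Dart} (h : d ∈ l)
    (h' : R.inv d ∉ l) : walkChain l d = 1 := by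
  classical
  simp [walkChain, List.count_eq_one_of_mem hn h, List.count_eq_zero_of_not_mem h']

end WalkChain

end RotationSystem

namespace RotationSystem

/-! ### The two sides of the cut-path -/

theorem IsWalk.mem_map_tgt {R : RotationSystem} {l : List R.Dart} {u w : R.Vertex}
    (h : IsWalk u l w) (huw : u ≠ w) : ∃ d ∈ l, tgt d = w := by
  induction l generalizing u with
  | nil => exact absurd h huw
  | cons e l ih =>
    by_cases he : tgt e = w
    · exact ⟨e, by simp, he⟩
    · obtain ⟨d, hd, hdw⟩ := ih h.2 he
      exact ⟨d, by simp [hd], hdw⟩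

theorem IsWalk.src_ne_end {R : RotationSystem} {l : List R.Dart} {u w : R.Vertex}
    (h : IsWalk u l w) (hn : (u :: l.map tgt).Nodup) {d : R.Dart} (hd : d ∈ l) : src d ≠ w := by
  induction l generalizing u with
  | nil => simp at hd
  | cons e l ih =>
    have hn' : (tgt e :: l.map tgt).Nodup := (List.nodup_cons.1 hn).2
    rcases List.mem_cons.1 hd with rfl | hd
    · rintro rfl
      refine (List.nodup_cons.1 hn).1 (List.mem_map.2 ?_)
      by_cases he : tgt d = src d
      · exact ⟨d, by simp, he.trans h.1⟩
      · obtain ⟨x, hx, hxd⟩ := h.2.mem_map_tgt he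
        exact ⟨x, by simp [hx], hxd.trans h.1⟩
    · exact ih h.2 hn' hd

theorem IsWalk.apply_eq {β : Type*} {R : RotationSystem} {F : R.Dart → β} {l : List R.Dart}
    {u w : R.Vertex} (h : IsWalk u l w) (hF : ∀ y ∈ l, ∀ z ∈ l, tgt y = src z → F y = F z) :
    ∀ y ∈ l, ∀ z ∈ l, F y = F z := by
  induction l generalizing u with
  | nil => simp
  | cons e l ih =>
    have hl := ih h.2 fun y hy z hz => hF y (by simp [hy]) z (by simp [hz])
    have he : ∀ z ∈ l, F e = F z := by
      intro z hz
      cases l with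
      | nil => simp at hz
      | cons e' l =>
        exact (hF e (by simp) e' (by simp) h.2.1.symm).trans (hl e' (by simp) z hz)
    intro y hy z hz
    rcases List.mem_cons.1 hy with hy' | hy' <;> rcases List.mem_cons.1 hz with hz' | hz'
    · rw [hy', hz']
    · exact hy' ▸ he z hz'
    · exact hz' ▸ (he y hy').symm
    · exact hl y hy' z hz'

/-- If a function on the oriented edges at a vertex drops by one after `z`, in the cyclic order, and
changes nowhere else before `y'`, then it is still lower by one at `y'`. -/
theorem eq_sub_one_of_drop_at {R : RotationSystem} {F : R.Dart → ℚ} {z y' : R.Dart}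
    (hyz : src y' = src z) (hne : y' ≠ z) (hz : F (R.rot z) = F z - 1)
    (hF : ∀ x, src x = src z → x ≠ z → x ≠ y' → F (R.rot x) = F x) : F y' = F z - 1 := by
  obtain ⟨n, hn, rfl⟩ := exists_iterate_rot_eq hyz
  have key : ∀ k < n, F (R.rot^[k + 1] z) = F z - 1 := by
    intro k
    induction k with
    | zero => exact fun _ => hz
    | succ k ih =>
      intro hk
      rw [Function.iterate_succ_apply', hF _ (src_iterate_rot z _) ?_ ?_, ih (by omega)]
      · intro h
        have := iterate_rot_inj z (m := k + 1) (n := 0) (by omega) (by omega) h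
        omega
      · intro h
        have := iterate_rot_inj z (by omega) hn h
        omega
  cases n with
  | zero => exact absurd rfl hne
  | succ n => exact key n (by omega)

end RotationSystem

namespace LopspOperation

open RotationSystem Equiv.Perm

variable {O : LopspOperation}

namespace CutPath

variable (P : O.CutPath)

/-- The oriented edges of the cut-path. -/
def darts : List O.Dart := P.part1 ++ P.part2

theorem darts_nodup : P.darts.Nodup := List.Nodup.of_map _ (List.nodup_cons.1 P.nodup).2

theorem tgt_ne_v1 {y : O.Dart} (hy : y ∈ P.darts) : tgt y ≠ O.v1 := fun h =>
  (List.nodup_cons.1 P.nodup).1 (List.mem_map.2 ⟨y, hy, h⟩)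

theorem src_ne_v2 {y : O.Dart} (hy : y ∈ P.darts) : src y ≠ O.v2 :=
  P.isWalk.src_ne_end P.nodup hy

theorem inv_notMem_darts {y : O.Dart} (hy : y ∈ P.darts) : O.inv y ∉ P.darts :=
  P.isWalk.inv_notMem P.nodup hy

theorem exists_first : ∃ a ∈ P.part1, src a = O.v1 := by
  have h := P.isWalk1
  cases hp : P.part1 with
  | nil => rw [hp] at h; exact absurd h.symm O.v0_ne_v1
  | cons a l => rw [hp] at h; exact ⟨a, by simp, h.1⟩

theorem exists_last : ∃ b ∈ P.part2, tgt b = O.v2 := P.isWalk2.mem_map_tgt O.v0_ne_v2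

/-- As the cut-path passes through `v₀`, it does not consist of one edge. -/
theorem tgt_ne_v2_of_src_eq_v1 {y : O.Dart} (hy : y ∈ P.darts) (h1 : src y = O.v1) :
    tgt y ≠ O.v2 := by
  intro h2
  obtain ⟨a, ha, ha1⟩ := P.exists_first
  obtain ⟨b, hb, hb2⟩ := P.exists_last
  have hya : y = a := P.isWalk.src_inj P.nodup hy (by simp [ha]) (h1.trans ha1.symm)
  have hyb : y = b := P.tgt_inj hy (by simp [hb]) (h2.trans hb2.symm)
  exact List.disjoint_of_nodup_append P.darts_nodup ha ((hya.symm.trans hyb) ▸ hb)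

/-- The cut-path and an edge from `v₂` to `v₁` form a closed walk in the plane, hence its chain
bounds. -/
theorem exists_height (hadj : ∃ e : O.Dart, src e = O.v2 ∧ tgt e = O.v1) :
    ∃ h : O.Face → ℚ, (∀ y ∈ P.darts, h (faceOf y) - h (faceOf (O.inv y)) = 1) ∧
      ∀ y, src y ≠ O.v1 → src y ≠ O.v2 → y ∉ P.darts → O.inv y ∉ P.darts →
        h (faceOf y) = h (faceOf (O.inv y)) := by
  obtain ⟨e, he2, he1⟩ := hadj
  have : Fintype O.Dart := Fintype.ofFinite _
  have hwalk : IsWalk O.v1 (P.darts ++ [e]) O.v1 := P.isWalk.append ⟨he2, he1⟩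
  have hnodup : (P.darts ++ [e]).Nodup := by
    refine List.Nodup.append P.darts_nodup (by simp) ?_
    intro y hy hye
    rw [List.mem_singleton.1 hye] at hy
    exact P.tgt_ne_v1 hy he1
  obtain ⟨h, hh⟩ := exists_boundary_eq O.connected O.plane (walkChain_mem_cycles hwalk)
  refine ⟨h, fun y hy => ?_, fun y h1 h2 hy hy' => ?_⟩
  · rw [hh, walkChain_eq_one hnodup (by simp [hy])]
    simp only [List.mem_append, List.mem_singleton, not_or]
    refine ⟨P.inv_notMem_darts hy, fun hye => P.tgt_ne_v2_of_src_eq_v1 hy ?_ ?_⟩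
    · rw [← tgt_inv y, hye, he1]
    · rw [← src_inv, hye, he2]
  · rw [← sub_eq_zero, hh, walkChain_eq_zero]
    · simp only [List.mem_append, List.mem_singleton, not_or]
      exact ⟨hy, fun hye => h2 (hye ▸ he2)⟩
    · simp only [List.mem_append, List.mem_singleton, not_or]
      refine ⟨hy', fun hye => h1 ?_⟩
      rw [← tgt_inv y, hye, he1]

/-- The cut-path and an edge from `v₂` to `v₁` separate the faces of `O`: there is a set of faces
that contains the faces on the one side of the cut-path and not those on the other side, and of
which the boundary contains no other edges, except possibly edges between `v₁` and `v₂`. -/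
theorem exists_side (hadj : ∃ e : O.Dart, src e = O.v2 ∧ tgt e = O.v1) :
    ∃ S : Set O.Face, (∀ y ∈ P.darts, faceOf y ∈ S ∧ faceOf (O.inv y) ∉ S) ∧
      ∀ y, src y ≠ O.v1 → src y ≠ O.v2 → y ∉ P.darts → O.inv y ∉ P.darts →
        (faceOf y ∈ S ↔ faceOf (O.inv y) ∈ S) := by
  obtain ⟨h, h1, h0⟩ := P.exists_height hadj
  have hstep : ∀ y ∈ P.darts, ∀ z ∈ P.darts, tgt y = src z →
      h (faceOf y) = h (faceOf z) := by
    intro y hy z hz hyz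
    have hrot : h (faceOf (O.inv y)) = h (faceOf z) - 1 := by
      refine eq_sub_one_of_drop_at (F := fun x => h (faceOf x)) hyz ?_ ?_ ?_
      · rintro rfl
        exact P.inv_notMem_darts hy hz
      · rw [faceOf_rot, ← h1 z hz]
        ring
      · intro x hx hxz hxy
        rw [faceOf_rot]
        refine (h0 x ?_ ?_ (fun hxP => hxz ?_) fun hxP => hxy ?_).symm
        · rw [hx, ← hyz]
          exact P.tgt_ne_v1 hy
        · rw [hx]
          exact P.src_ne_v2 hz
        · exact P.isWalk.src_inj P.nodup hxP hz hx
        · rw [← P.tgt_inj hxP hy (by rw [tgt_inv, hx, hyz]), O.inv_inv]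
    linarith [h1 y hy]
  have hconst := P.isWalk.apply_eq (F := fun y => h (faceOf y)) hstep
  obtain ⟨a, ha, -⟩ := P.exists_first
  have haP : a ∈ P.part1 ++ P.part2 := by simp [ha]
  refine ⟨{f | h f = h (faceOf a)}, fun y hy => ⟨hconst y hy a haP, fun hy' => ?_⟩,
    fun y hy1 hy2 hy hy' => ?_⟩
  · have h2 := h1 y hy
    rw [hconst y hy a haP, show h (faceOf (O.inv y)) = h (faceOf a) from hy'] at h2
    norm_num at h2
  · change h _ = _ ↔ h _ = _
    rw [h0 y hy1 hy2 hy hy']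

end CutPath

/-! ### The islands of the vertices of `G` -/

section Island

variable {P : O.CutPath} {G : RotationSystem}

open Classical in
/-- The cut-path and an edge from `v₂` to `v₁` divide the double chamber patch into two halves. The
half on the side `S` contains in the double chamber `d` the corner `tgt d`, the other one `src d`.
This is the corner for the copy of the face of `y` in the double chamber `d`. -/
noncomputable def island (S : Set O.Face) (G : RotationSystem) (y : O.Dart) (d : G.Dart) :
    G.Vertex :=
  if faceOf y ∈ S then tgt d else src d

theorem island_inv {S : Set O.Face}
    (hS1 : ∀ y ∈ P.darts, faceOf y ∈ S ∧ faceOf (O.inv y) ∉ S)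
    (hS0 : ∀ y, src y ≠ O.v1 → src y ≠ O.v2 → y ∉ P.darts → O.inv y ∉ P.darts →
      (faceOf y ∈ S ↔ faceOf (O.inv y) ∈ S))
    {y : O.Dart} (h1 : src y ≠ O.v1) (h2 : src y ≠ O.v2) (d : G.Dart) :
    island S G (O.inv y) (cross P G y d) = island S G y d := by
  by_cases hy : y ∈ P.darts
  · obtain ⟨hin, hout⟩ := hS1 y hy
    rw [island, if_neg hout, island, if_pos hin]
    rcases List.mem_append.1 hy with hy | hy
    · rw [P.cross_part1 G hy]
      rfl
    · rw [P.cross_part2 G hy, src_next]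
  · by_cases hy' : O.inv y ∈ P.darts
    · obtain ⟨hin, hout⟩ := hS1 _ hy'
      rw [O.inv_inv] at hout
      rw [island, if_pos hin, island, if_neg hout]
      have hcross : cross P G y = (cross P G (O.inv y))⁻¹ := by
        rw [P.cross_inv_eq, _root_.inv_inv]
      rw [hcross]
      rcases List.mem_append.1 hy' with hy' | hy'
      · rw [P.cross_part1 G hy', ← tgt_inv]
        congr 1
        rw [Equiv.Perm.inv_eq_iff_eq, G.inv_inv]
      · rw [P.cross_part2 G hy', ← src_next, ← mul_apply, mul_inv_cancel, one_apply]
    · rw [P.cross_eq_one G hy hy']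
      classical exact if_congr (hS0 y h1 h2 hy hy').symm rfl rfl

theorem island_rot {S : Set O.Face} (y : O.Dart) (d : G.Dart) :
    island S G (O.rot y) d = island S G (O.inv y) d := by
  classical exact if_congr (by rw [faceOf_rot]) rfl rfl

/-- For every copy of a face of `O` there is a copy in another island. -/
theorem exists_island_ne (S : Set O.Face) (y : O.Dart) [Nontrivial G.Vertex] (v : G.Vertex) :
    ∃ d : G.Dart, island S G y d ≠ v := by
  obtain ⟨w, hw⟩ := exists_ne v
  obtain ⟨d, rfl⟩ := exists_src_eq w
  by_cases hy : faceOf y ∈ S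
  · refine ⟨G.inv d, ?_⟩
    rwa [island, if_pos hy, tgt_inv]
  · refine ⟨d, ?_⟩
    rwa [island, if_neg hy]

end Island

/-! ### The vertices of `O(G)` in the faces of `G` -/

section FaceVertices

variable (P : O.CutPath) (G : RotationSystem)

/-- At `v₂`, exactly one edge belongs to the cut-path. -/
theorem CutPath.cross_around_v2 : ∃ q : O.Dart, src q = O.v2 ∧ cross P G q = G.next⁻¹ ∧
    ∀ z : O.Dart, src z = O.v2 → z ≠ q → cross P G z = 1 := by
  obtain ⟨b, hb, hb2⟩ := P.exists_last
  refine ⟨O.inv b, hb2, by rw [P.cross_inv_eq, P.cross_part2 G hb], fun z hz hzq => ?_⟩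
  refine P.cross_eq_one G (fun h => P.src_ne_v2 h hz) fun h => hzq ?_
  rw [← P.tgt_inj h (z := b) (by simp [hb]) (by rw [tgt_inv, hz, hb2]), O.inv_inv]

/-- The copies of `v₂` in the double chambers of one face of `G` are the same vertex. -/
theorem glue_sameCycle_of_faceOf_eq {y z : O.Dart} (hy : src y = O.v2) (hz : src z = O.v2)
    {d e : G.Dart} (hde : faceOf d = faceOf e) : (O.glue P G).rot.SameCycle (y, d) (z, e) := by
  obtain ⟨q, hq, hcq, hc⟩ := P.cross_around_v2 G
  have hreach : ∀ x : O.Dart, src x = O.v2 → ∀ d : G.Dart,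
      (O.glue P G).rot.SameCycle (O.rot q, d) (x, d) := by
    intro x hx d
    have hiter : ∀ n < degree (src q),
        (O.glue P G).rot.SameCycle (O.rot q, d) (O.rot^[n + 1] q, d) := by
      intro n
      induction n with
      | zero => exact fun _ => SameCycle.refl _ _
      | succ n ih =>
        intro hn
        refine (ih (by omega)).trans (sameCycle_of_apply_eq ?_)
        have hne : O.rot^[n + 1] q ≠ q := fun h => by
          have := iterate_rot_inj q (m := n + 1) (n := 0) hn (by omega) h
          omega
        refine Prod.ext (Function.iterate_succ_apply' O.rot _ _).symm ?_
        exact congrArg (· d) (hc _ ((src_iterate_rot q _).trans hq) hne)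
    obtain ⟨n, hn, rfl⟩ := exists_iterate_rot_eq (hx.trans hq.symm)
    cases n with
    | zero =>
      have h := hiter (degree (src q) - 1) (by omega)
      rwa [Nat.sub_add_cancel (by omega), iterate_rot_degree] at h
    | succ n => exact hiter n (by omega)
  have hturn : ∀ d : G.Dart, (O.glue P G).rot.SameCycle (O.rot q, G.next d) (O.rot q, d) := by
    intro d
    refine (hreach q hq (G.next d)).trans (sameCycle_of_apply_eq ?_)
    refine Prod.ext rfl ((congrArg (· (G.next d)) hcq).trans ?_)
    exact G.next.symm_apply_apply d
  have hface : (O.glue P G).rot.SameCycle (O.rot q, d) (O.rot q, e) :=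
    (faceOf_eq_faceOf_iff.1 hde).of_semiconj (j := fun d => (O.rot q, d)) fun d => (hturn d).symm
  exact (hreach y hy d).symm.trans (hface.trans (hreach z hz e))

theorem type_tgt_iterate_rot_odd (y : O.Dart) (n : ℕ) :
    O.type (tgt (O.rot^[2 * n + 1] y)) ≠ O.type (tgt y) := by
  induction n generalizing y with
  | zero => exact O.type_tgt_rot_ne y
  | succ n ih =>
    rw [show 2 * (n + 1) + 1 = (2 * n + 1) + 1 + 1 by ring, Function.iterate_succ_apply,
      Function.iterate_succ_apply, ← O.type_tgt_rot_sq y]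
    exact ih _

theorem glue_iterate_rot_fst (x : (O.glue P G).Dart) (n : ℕ) :
    ((O.glue P G).rot^[n] x).1 = O.rot^[n] x.1 := by
  induction n with
  | zero => rfl
  | succ n ih =>
    rw [Function.iterate_succ_apply', Function.iterate_succ_apply', ← ih]
    rfl

variable {P G}

/-- A turn between two oriented edges of `O(G)` has an even number of steps, because the types of
the ends alternate. -/
theorem apply_src_eq_of_sameCycle {x x' : (O.apply P G).Dart}
    (h : (O.glue P G).rot.SameCycle x.1 x'.1) : src x = src x' := by
  refine src_eq_src_iff.2 ((sameCycle_subtypePerm (h := isResultDart_rot)).2 ?_)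
  obtain ⟨n, hn⟩ := h.exists_nat_pow_eq
  obtain ⟨m, rfl | rfl⟩ := n.even_or_odd'
  · exact ⟨m, by rw [zpow_natCast, ← pow_mul, hn]⟩
  · refine absurd ?_ (type_tgt_iterate_rot_odd x.1.1 m)
    rw [← glue_iterate_rot_fst P G, ← coe_pow, hn, x'.2.2, x.2.2]

end FaceVertices

/-! ### Disconnecting `O(G)` -/

section Disconnect

variable {P : O.CutPath} {G : RotationSystem}

theorem src_ne_v1_of_type (hv1 : O.type O.v1 ≠ 0) {y : O.Dart} (hy : O.type (src y) = 0) :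
    src y ≠ O.v1 := fun h => hv1 (h ▸ hy)

theorem apply_island_rot {S : Set O.Face}
    (hS : ∀ y : O.Dart, src y ≠ O.v1 → src y ≠ O.v2 → ∀ d : G.Dart,
      island S G (O.inv y) (cross P G y d) = island S G y d)
    {x : (O.glue P G).Dart} (h1 : src x.1 ≠ O.v1) (h2 : src x.1 ≠ O.v2) :
    island S G ((O.glue P G).rot x).1 ((O.glue P G).rot x).2 = island S G x.1 x.2 := by
  rw [glue_rot, island_rot, hS _ h1 h2]

/-- If `v₁` has type 1, then its neighbours of type 0 coincide with `v₂`. -/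
theorem src_eq_v2_of_tgt_eq_v1 (hO : O.IsEdgeBreaking) {y : O.Dart} (h0 : O.type (src y) = 0)
    (h1 : O.type (tgt y) = 1) (hy : tgt y = O.v1) : src y = O.v2 := by
  obtain ⟨⟨a, ha1, ha2⟩, htype⟩ := hO
  obtain ⟨n, hn, hna⟩ := exists_iterate_rot_eq (d := a) (d' := O.inv y) (hy.trans ha1.symm)
  rw [ha1, O.degree_v1 (hy ▸ h1)] at hn
  interval_cases n
  · rw [← ha2, show a = O.inv y from hna, tgt_inv]
  · refine absurd ?_ (O.type_tgt_rot_ne a)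
    rw [show O.rot a = O.inv y from hna, tgt_inv, h0, ha2, htype]

theorem not_isKConnected_three_apply (hO : O.IsEdgeBreaking) [Nontrivial G.Vertex]
    (hG : Nat.card G.Face ≤ 2) (P : O.CutPath) : ¬ (O.apply P G).IsKConnected 3 := by
  rintro ⟨hcard, hcut⟩
  have hadj : ∃ e : O.Dart, src e = O.v2 ∧ tgt e = O.v1 := by
    obtain ⟨⟨a, ha1, ha2⟩, -⟩ := hO
    exact ⟨O.inv a, ha2, (tgt_inv a).trans ha1⟩
  have hv1 : O.type O.v1 ≠ 0 := by
    obtain ⟨⟨a, ha1, ha2⟩, htype⟩ := hO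
    rw [← ha1, ← htype, ← ha2]
    exact O.type_ne a
  obtain ⟨S, hS1, hS0⟩ := P.exists_side hadj
  have hS : ∀ y : O.Dart, src y ≠ O.v1 → src y ≠ O.v2 → ∀ d : G.Dart,
      island S G (O.inv y) (cross P G y d) = island S G y d :=
    fun y h1 h2 d => island_inv hS1 hS0 h1 h2 d
  classical
  -- The island of a vertex of `O(G)`, and `none` for the copies of `v₂`.
  let I₀ : (O.apply P G).Dart → Option G.Vertex := fun x =>
    if src x.1.1 = O.v2 then none else some (island S G x.1.1 x.1.2)
  have hI₀ : ∀ x, I₀ ((O.apply P G).rot x) = I₀ x := by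
    intro x
    have hsrc : src ((O.apply P G).rot x).1.1 = src x.1.1 :=
      (src_rot (O.rot x.1.1)).trans (src_rot x.1.1)
    by_cases h2 : src x.1.1 = O.v2
    · simp only [I₀, hsrc, if_pos h2]
    · have h1 := src_ne_v1_of_type hv1 x.2.1
      have e1 := apply_island_rot hS h1 h2
      have e2 := apply_island_rot hS (x := (O.glue P G).rot x.1)
        (by rwa [glue_rot, src_rot]) (by rwa [glue_rot, src_rot])
      simp only [I₀, hsrc, if_neg h2]
      exact congrArg some (e2.trans e1)
  let I : (O.apply P G).Vertex → Option G.Vertex := Quotient.lift I₀ fun _ _ h =>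
    SameCycle.apply_eq_of_invariant hI₀ h
  have hI : ∀ x, I (src x) = I₀ x := fun _ => rfl
  have hnone : ∀ x, I (src x) = none ↔ src x.1.1 = O.v2 := by
    intro x
    simp [hI, I₀]
  have hsome : ∀ x, src x.1.1 ≠ O.v2 → I (src x) = some (island S G x.1.1 x.1.2) := by
    intro x hx
    rw [hI]
    exact if_neg hx
  let X : Set (O.apply P G).Vertex := {u | I u = none}
  have hX : X.ncard < 3 := by
    refine lt_of_le_of_lt ?_ (Nat.lt_succ_of_le hG)
    rw [← Nat.card_coe_set_eq]
    refine Nat.card_le_card_of_injective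
      (fun u : X => faceOf (Quotient.out u.1 : (O.apply P G).Dart).1.2) ?_
    rintro ⟨u, hu⟩ ⟨v, hv⟩ huv
    have hout : ∀ u : (O.apply P G).Vertex, src (Quotient.out u) = u := fun u => Quotient.out_eq u
    refine Subtype.ext ?_
    change u = v
    rw [← hout u, ← hout v]
    refine apply_src_eq_of_sameCycle (glue_sameCycle_of_faceOf_eq P G ?_ ?_ huv)
    · exact (hnone _).1 ((congrArg I (hout u)).trans hu)
    · exact (hnone _).1 ((congrArg I (hout v)).trans hv)
  -- Adjacent vertices that are not copies of `v₂` lie in the same island.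
  have hedge : ∀ x : (O.apply P G).Dart, src x ∉ X → tgt x ∉ X → I (src x) = I (tgt x) := by
    intro x hx hx'
    have h2 : src x.1.1 ≠ O.v2 := fun h => hx ((hnone x).2 h)
    have h2' : src ((O.apply P G).inv x).1.1 ≠ O.v2 := fun h => hx' ((hnone _).2 h)
    have h1 := src_ne_v1_of_type hv1 x.2.1
    have ht1 : tgt x.1.1 ≠ O.v1 := fun h => h2 (src_eq_v2_of_tgt_eq_v1 hO x.2.1 x.2.2 h)
    have ht2 : tgt x.1.1 ≠ O.v2 := fun h => O.type_v2 (h ▸ x.2.2)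
    rw [tgt, hsome x h2, hsome _ h2']
    refine congrArg some (Eq.symm ?_)
    set y := (O.glue P G).inv x.1 with hy
    have hysrc : src y.1 = tgt x.1.1 := rfl
    have e0 : island S G y.1 y.2 = island S G x.1.1 x.1.2 := hS _ h1 h2 _
    have e1 := apply_island_rot hS (x := y) ht1 ht2
    have e2 := apply_island_rot hS (x := (O.glue P G).rot y)
      (by rwa [glue_rot, src_rot]) (by rwa [glue_rot, src_rot])
    have hsrc3 : src ((O.glue P G).rot ((O.glue P G).rot y)).1 = tgt x.1.1 :=
      (src_rot (O.rot y.1)).trans (src_rot y.1)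
    have e3 := hS ((O.glue P G).rot ((O.glue P G).rot y)).1 (by rwa [hsrc3]) (by rwa [hsrc3])
      ((O.glue P G).rot ((O.glue P G).rot y)).2
    exact e3.trans (e2.trans (e1.trans e0))
  have hconn := hcut X hX
  have hconst : ∀ u v (hu : u ∉ X) (hv : v ∉ X), I u = I v := by
    intro u v hu hv
    obtain ⟨w⟩ := hconn.preconnected ⟨u, hu⟩ ⟨v, hv⟩
    have key : ∀ a b : (Xᶜ : Set _), ((O.apply P G).graph.induce Xᶜ).Walk a b → I a.1 = I b.1 := by
      intro a b w
      induction w with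
      | nil => rfl
      | @cons a b c hab _ ih =>
        obtain ⟨-, x, hxa, hxb⟩ := graph_adj.1 (show (O.apply P G).graph.Adj a.1 b.1 from hab)
        rw [← ih, ← hxa, ← hxb]
        exact hedge x (hxa ▸ a.2) (hxb ▸ b.2)
    exact key _ _ w
  obtain ⟨u, hu⟩ := hconn.nonempty
  obtain ⟨x, rfl⟩ := exists_src_eq u
  have hx2 : src x.1.1 ≠ O.v2 := fun h => hu ((hnone x).2 h)
  obtain ⟨d, hd⟩ := exists_island_ne S x.1.1 (island S G x.1.1 x.1.2)
  let x' : (O.apply P G).Dart := ⟨(x.1.1, d), x.2⟩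
  have h := hconst (src x') (src x) (fun h => hx2 ((hnone x').1 h)) hu
  rw [hsome x' hx2, hsome x hx2] at h
  exact hd (Option.some_injective _ h)

end Disconnect

end LopspOperation

theorem theorem3p2 (O : LopspOperation) (hO : O.IsEdgeBreaking) (hc3 : O.IsC3)
    (g : ℕ) (hg : 0 < g) :
    ∃ G : EmbeddedGraph, G.IsSimple ∧ G.IsKConnected 3 ∧ G.genus = g ∧
      ∀ P : O.CutPath, ¬ (O.apply P G.toRotationSystem).IsKConnected 3 := by
  obtain ⟨G, hsimple, hconn, hgenus, hface⟩ := EmbeddedGraph.exists_two_faces g hg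
  have hcard := hconn.1
  have : Nontrivial G.Vertex := Finite.one_lt_card_iff_nontrivial.1 (by omega)
  exact ⟨G, hsimple, hconn, hgenus, fun P =>
    LopspOperation.not_isKConnected_three_apply hO hface.le P⟩
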